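/- Let $\mathbb K$ be a field of characteristic zero. A noncrossing partition is a partition $\pi$ of $[n]=\{1,\dots,n\}$, $n\ge 1$, into nonempty blocks such that there are no distinct blocks $b,b'$ and $x,z\in b$, $y,t\in b'$ with $x<y<z<t$; $|\pi|$ is its number of blocks, and for a set $S$ of blocks of $\pi$, $\pi_{|S}$ is the noncrossing partition obtained by keeping only the blocks in $S$ and relabelling increasingly ($\pi_{|\emptyset}=1$). Let $\mathbb K[\mathcal{NCP}]$ be the free commutative algebra generated by the noncrossing partitions, with the two multiplicative coproducts given on a noncrossing partition $\pi$ by \[\Delta(\pi)=\sum_{J}\pi_{|\pi\setminus J}\otimes\prod_{C}\pi_{|C},\qquad \delta(\pi)=\sum_{\sim}\pi/{\sim}\;\otimes\prod_{c}\pi_{|c}.\] In the first sum $J$ runs over the sets of blocks of $\pi$ such that each connected component (maximal interval of consecutive integers) of $\bigcup J$ is a union of blocks of $\pi$, and $C$ runs over these components. In the second sum $\sim$ runs over the equivalence relations on the set of blocks of $\pi$ such that the partition $\pi/{\sim}$, obtained by merging equivalent blocks, is noncrossing, and $c$ runs over the classes of $\sim$. The counits are the characters $\varepsilon_\Delta$,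 $\epsilon_\delta$ with $\varepsilon_\Delta(\pi)=0$, and $\epsilon_\delta(\pi)=1$ if $|\pi|=1$ and $0$ otherwise. The algebra $\mathbb K[X]$ carries the multiplicative coproducts with $\Delta(X)=X\otimes1+1\otimes X$ and $\delta(X)=X\otimes X$, with counits $P\mapsto P(0)$ and $P\mapsto P(1)$. There is a unique algebra morphism $\phi_{\mathcal{NCP}}:\mathbb K[\mathcal{NCP}]\to\mathbb K[X]$ compatible with both coproducts and both counits. Call $\pi$ nesting-free if all its blocks are minimal for the order $b\le b'\iff b'\subseteq[\min b,\max b]$. Then $\phi_{\mathcal{NCP}}(\pi)$ for nesting-free $\pi$ depends only on $n=|\pi|$; denote it by $P_n(X)$, and put $P_0=1$. Let $M=(M_{k,l})_{k,l\ge1}$ be the infinite lower triangular matrix with $M_{k,l}=\binom{l}{k-l}$ if $k\ge l$ and $M_{k,l}=0$ if $k<l$. Then \[\begin{pmatrix}P_0(X)\\P_1(X)\\P_2(X)\\\vdots\end{pmatrix}=e^{X\ln(M)}\begin{pmatrix}1\\0\\0\\\vdots\end{pmatrix},\] where $\ln(M)=\sum_{n\ge1}\frac{(-1)^{n-1}}{n}(M-I)^n$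 and $e^{X\ln(M)}=\sum_{n\ge0}\frac{X^n}{n!}\ln(M)^n$ are entrywise finite sums. Moreover $M$ is the Riordan array of $(1+X,X(1+X))$: for every $l\ge1$, $\sum_{k\ge1}M_{k,l}X^{k-1}=(1+X)\,(X(1+X))^{l-1}$. -/

import Mathlib

open scoped TensorProduct

noncomputable section

/-! ## Noncrossing partitions

Blocks are finite sets of natural numbers, and `[n] = {1, …, n}` is `Finset.Icc 1 n`. -/

/-- No two distinct blocks of the family cross. -/
def IsNoncrossing (S : Finset (Finset ℕ)) : Prop :=
  ∀ b ∈ S, ∀ b' ∈ S, b ≠ b' →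
    ∀ x ∈ b, ∀ z ∈ b, ∀ y ∈ b', ∀ t ∈ b', ¬ (x < y ∧ y < z ∧ z < t)

/-- A finite family of pairwise disjoint nonempty finite sets. -/
def IsBlockFamily (S : Finset (Finset ℕ)) : Prop :=
  ∅ ∉ S ∧ (S : Set (Finset ℕ)).PairwiseDisjoint id

/-- The union of the blocks of a family. -/
def supp (S : Finset (Finset ℕ)) : Finset ℕ := S.sup id

/-- `S` is the set of blocks of a noncrossing partition of `[n]` for some `n ≥ 1`. -/
def IsNCPartition (S : Finset (Finset ℕ)) : Prop :=
  S.Nonempty ∧ IsBlockFamily S ∧ (∃ n : ℕ, supp S = Finset.Icc 1 n) ∧ IsNoncrossing S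

/-- The type of (nonempty) noncrossing partitions. -/
def NCPartition : Type := {S : Finset (Finset ℕ) // IsNCPartition S}

namespace NCPartition

/-- The set of blocks of a noncrossing partition. -/
def blocks (π : NCPartition) : Finset (Finset ℕ) := π.1

/-- The number of blocks `|π|`. -/
def numBlocks (π : NCPartition) : ℕ := π.blocks.card

/-- The nesting relation `b ≤ b'`, that is `b' ⊆ [min b, max b]`: every point of `b'` has a point
of `b` weakly to its left and a point of `b` weakly to its right. -/
def NestLE (b b' : Finset ℕ) : Prop :=
  ∀ y ∈ b', (∃ x ∈ b, x ≤ y) ∧ (∃ z ∈ b, y ≤ z)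

open Classical in
/-- The base of `π`: its blocks which are minimal for the nesting order. -/
def base (π : NCPartition) : Finset (Finset ℕ) :=
  π.blocks.filter fun b => ∀ b' ∈ π.blocks, NestLE b' b → b' = b

/-- `π` has no nesting: all its blocks are minimal for the nesting order. -/
def NestingFree (π : NCPartition) : Prop := π.base = π.blocks

end NCPartition

/-! ## Standardisation and the algebra of noncrossing partitions -/

/-- On `U`, this is the increasing bijection from `U` to `[|U|]`. -/
def rankIn (U : Finset ℕ) (x : ℕ) : ℕ := (U.filter (· ≤ x)).card

/-- Relabel a family of blocks along the increasing bijection from its support `U` to `[|U|]`. -/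
def standardize (S : Finset (Finset ℕ)) : Finset (Finset ℕ) :=
  S.image fun b => b.image (rankIn (supp S))

/-- `𝕂[NCP]`: the free commutative algebra on the noncrossing partitions. -/
abbrev NCAlg (K : Type*) [Field K] : Type _ := MvPolynomial NCPartition K

open Classical in
/-- The generator of `𝕂[NCP]` given by a noncrossing partition with block set `S`; the empty family
gives the unit `1`. -/
def ofBlocks (K : Type*) [Field K] (S : Finset (Finset ℕ)) : NCAlg K :=
  if h : IsNCPartition S then MvPolynomial.X (⟨S, h⟩ : NCPartition) else 1

/-- The element of `𝕂[NCP]` given by a finite noncrossing family of blocks, after standardisation.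
For a subfamily `S` of the blocks of `π` this is the restriction of `π` to `S`. -/
def restr (K : Type*) [Field K] (S : Finset (Finset ℕ)) : NCAlg K :=
  ofBlocks K (standardize S)

lemma mem_supp {S : Finset (Finset ℕ)} {x : ℕ} : x ∈ supp S ↔ ∃ b ∈ S, x ∈ b := by
  simp [supp, Finset.mem_sup]

lemma rankIn_lt {U : Finset ℕ} {x y : ℕ} (hy : y ∈ U) (h : x < y) : rankIn U x < rankIn U y := by
  apply Finset.card_lt_card
  rw [Finset.ssubset_iff_of_subset]
  · exact ⟨y, by simp [hy], by simp [h]⟩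
  · intro z hz
    simp only [Finset.mem_filter] at hz ⊢
    exact ⟨hz.1, hz.2.trans h.le⟩

lemma rankIn_lt_iff {U : Finset ℕ} {x y : ℕ} (hx : x ∈ U) (hy : y ∈ U) :
    rankIn U x < rankIn U y ↔ x < y := by
  refine ⟨fun h => ?_, rankIn_lt hy⟩
  by_contra! h'
  rcases h'.lt_or_eq with h' | h'
  · exact absurd (rankIn_lt hx h') (by omega)
  · subst h'; omega

lemma rankIn_injOn (U : Finset ℕ) : Set.InjOn (rankIn U) U := by
  intro x hx y hy h
  rcases lt_trichotomy x y with h' | h' | h'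
  · have := rankIn_lt hy h'; omega
  · exact h'
  · have := rankIn_lt hx h'; omega

lemma image_rankIn (U : Finset ℕ) : U.image (rankIn U) = Finset.Icc 1 U.card := by
  apply Finset.eq_of_subset_of_card_le
  · intro r hr
    obtain ⟨x, hx, rfl⟩ := Finset.mem_image.1 hr
    rw [Finset.mem_Icc]
    exact ⟨Finset.card_pos.2 ⟨x, by simp [hx]⟩, Finset.card_le_card (Finset.filter_subset _ _)⟩
  · rw [Finset.card_image_of_injOn (rankIn_injOn U)]; simp

/-- The standardisation of a nonempty noncrossing family of blocks is a noncrossing partition, so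
that the default value `1` in `ofBlocks` is only used for the empty family. -/
lemma isNCPartition_standardize {S : Finset (Finset ℕ)} (h0 : S.Nonempty) (h1 : IsBlockFamily S)
    (h2 : IsNoncrossing S) : IsNCPartition (standardize S) := by
  have hs : ∀ {b x}, b ∈ S → x ∈ b → x ∈ supp S := fun hb hx => mem_supp.2 ⟨_, hb, hx⟩
  refine ⟨h0.image _, ⟨?_, ?_⟩, ⟨(supp S).card, ?_⟩, ?_⟩
  · intro h
    obtain ⟨b, hb, hb'⟩ := Finset.mem_image.1 h
    rw [Finset.image_eq_empty] at hb'
    exact h1.1 (hb' ▸ hb)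
  · intro c hc d hd hcd
    obtain ⟨b, hb, rfl⟩ := Finset.mem_image.1 hc
    obtain ⟨b', hb', rfl⟩ := Finset.mem_image.1 hd
    have hne : b ≠ b' := fun h => hcd (by rw [h])
    have hdis : Disjoint b b' := h1.2 hb hb' hne
    simp only [Function.onFun, id]
    rw [Finset.disjoint_left]
    intro r hr hr'
    obtain ⟨x, hx, rfl⟩ := Finset.mem_image.1 hr
    obtain ⟨y, hy, hxy⟩ := Finset.mem_image.1 hr'
    have : y = x := rankIn_injOn _ (hs hb' hy) (hs hb hx) hxy
    exact Finset.disjoint_left.1 hdis hx (this ▸ hy)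
  · rw [← image_rankIn]
    ext r
    simp only [mem_supp, standardize, Finset.mem_image]
    constructor
    · rintro ⟨_, ⟨b, hb, rfl⟩, hr⟩
      obtain ⟨x, hx, rfl⟩ := Finset.mem_image.1 hr
      exact ⟨x, ⟨b, hb, hx⟩, rfl⟩
    · rintro ⟨x, ⟨b, hb, hx⟩, rfl⟩
      exact ⟨_, ⟨b, hb, rfl⟩, Finset.mem_image_of_mem _ hx⟩
  · intro c hc d hd hcd x' hx' z' hz' y' hy' t' ht'
    obtain ⟨b, hb, rfl⟩ := Finset.mem_image.1 hc
    obtain ⟨b', hb', rfl⟩ := Finset.mem_image.1 hd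
    have hne : b ≠ b' := fun h => hcd (by rw [h])
    obtain ⟨x, hx, rfl⟩ := Finset.mem_image.1 hx'
    obtain ⟨z, hz, rfl⟩ := Finset.mem_image.1 hz'
    obtain ⟨y, hy, rfl⟩ := Finset.mem_image.1 hy'
    obtain ⟨t, ht, rfl⟩ := Finset.mem_image.1 ht'
    rw [rankIn_lt_iff (hs hb hx) (hs hb' hy), rankIn_lt_iff (hs hb' hy) (hs hb hz),
      rankIn_lt_iff (hs hb hz) (hs hb' ht)]
    exact h2 b hb b' hb' hne x hx z hz y hy t ht

/-! ## The two coproducts and their counits -/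

/-- The connected component of `x` in `U`: all `y ∈ U` such that every integer between `x` and `y`
lies in `U`. -/
def component (U : Finset ℕ) (x : ℕ) : Finset ℕ :=
  U.filter fun y => Finset.uIcc x y ⊆ U

/-- The connected components of `U`, i.e. its maximal intervals of consecutive integers. -/
def components (U : Finset ℕ) : Finset (Finset ℕ) := U.image (component U)

/-- A set `J` of blocks of `π` is an ideal if each connected component of its union is a union of
blocks of `π`. -/
def IsNCIdeal (π : NCPartition) (J : Finset (Finset ℕ)) : Prop :=
  J ⊆ π.blocks ∧ ∀ C ∈ components (supp J), ∃ T ⊆ π.blocks, supp T = C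

variable (K : Type*) [Field K]

/-- The monomial `π_{|· J}`: the product of the restrictions of `π` to the connected components of
the union of `J`. -/
def restrComponents (J : Finset (Finset ℕ)) : NCAlg K :=
  ∏ C ∈ components (supp J), restr K (J.filter (· ⊆ C))

open Classical in
/-- The first coproduct: the algebra morphism which sends each noncrossing partition `π` to the sum
over its ideals `J` of `π_{| π \ J} ⊗ π_{|· J}`. -/
def ncDelta : NCAlg K →ₐ[K] NCAlg K ⊗[K] NCAlg K :=
  MvPolynomial.aeval fun π : NCPartition =>
    ∑ J ∈ π.blocks.powerset.filter (IsNCIdeal π),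
      restr K (π.blocks \ J) ⊗ₜ[K] restrComponents K J

/-- The counit of the first coproduct: it kills every noncrossing partition. -/
def ncCounitDelta : NCAlg K →ₐ[K] K :=
  MvPolynomial.aeval fun _ : NCPartition => (0 : K)

/-- The blocks of the quotient `π / ∼`; the equivalence `∼` on the blocks of `π` is given by its
classes, and the blocks in each class are merged. -/
def fuse {S : Finset (Finset ℕ)} (Q : Finpartition S) : Finset (Finset ℕ) :=
  Q.parts.image supp

open Classical in
/-- The extraction-contraction coproduct: the algebra morphism which sends each noncrossing
partition `π` to the sum of `(π / ∼) ⊗ ∏ π_{| class}` over the equivalences `∼` on the blocks of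
`π` such that `π / ∼` is noncrossing, where the product is over the classes of `∼`. -/
def ncdelta : NCAlg K →ₐ[K] NCAlg K ⊗[K] NCAlg K :=
  MvPolynomial.aeval fun π : NCPartition =>
    ∑ Q ∈ (Finset.univ : Finset (Finpartition π.blocks)).filter fun Q => IsNoncrossing (fuse Q),
      ofBlocks K (fuse Q) ⊗ₜ[K] ∏ c ∈ Q.parts, restr K c

/-- The counit of the extraction-contraction coproduct: it sends a noncrossing partition to `1` if
it has exactly one block, and to `0` otherwise. -/
def ncCounitdelta : NCAlg K →ₐ[K] K :=
  MvPolynomial.aeval fun π : NCPartition => if π.numBlocks = 1 then (1 : K) else 0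

/-- The additive coproduct of `𝕂[X]`, with `X ↦ X ⊗ 1 + 1 ⊗ X`. -/
def polyDelta : Polynomial K →ₐ[K] Polynomial K ⊗[K] Polynomial K :=
  Polynomial.aeval (Polynomial.X ⊗ₜ[K] 1 + 1 ⊗ₜ[K] Polynomial.X)

/-- The multiplicative coproduct of `𝕂[X]`, with `X ↦ X ⊗ X`. -/
def polydelta : Polynomial K →ₐ[K] Polynomial K ⊗[K] Polynomial K :=
  Polynomial.aeval (Polynomial.X ⊗ₜ[K] Polynomial.X)

variable {K}

/-- Morphisms of double bialgebras from `𝕂[NCP]` to `𝕂[X]`: algebra morphisms compatible with both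
coproducts and both counits. -/
structure IsDoubleBialgebraHom (φ : NCAlg K →ₐ[K] Polynomial K) : Prop where
  map_Delta : (Algebra.TensorProduct.map φ φ).comp (ncDelta K) = (polyDelta K).comp φ
  counit_Delta : (Polynomial.aeval (0 : K)).comp φ = ncCounitDelta K
  map_delta : (Algebra.TensorProduct.map φ φ).comp (ncdelta K) = (polydelta K).comp φ
  counit_delta : (Polynomial.aeval (1 : K)).comp φ = ncCounitdelta K

/-! ## Infinite lower triangular matrices -/

/-- The ring of infinite lower triangular matrices with rows and columns indexed by `ℕ`, as the
incidence algebra of `ℕ` with reversed order: the entry at `(k, l)` vanishes unless `l ≤ k`, and the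
product is the matrix product. -/
abbrev LowerTri (R : Type*) [Zero R] : Type _ := IncidenceAlgebra R ℕᵒᵈ

namespace LowerTri

/-- The entry in row `k` and column `l`. -/
def entry {R : Type*} [Zero R] (A : LowerTri R) (k l : ℕ) : R :=
  A (OrderDual.toDual k) (OrderDual.toDual l)

/-- The lower triangular matrix whose entry at `(k, l)` is `f k l` for `l ≤ k`. -/
def of {R : Type*} [Zero R] (f : ℕ → ℕ → R) : LowerTri R where
  toFun k l := if OrderDual.ofDual l ≤ OrderDual.ofDual k then
    f (OrderDual.ofDual k) (OrderDual.ofDual l) else 0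
  eq_zero_of_not_le' _ _ h := if_neg h

/-- The product of a lower triangular matrix with an infinite column vector. -/
def mulVec {R : Type*} [Semiring R] (A : LowerTri R) (v : ℕ → R) (k : ℕ) : R :=
  ∑ l ∈ Finset.range (k + 1), A.entry k l * v l

/-- The exponential series `∑ Nⁿ / n!`, summed entrywise (for strictly lower triangular `N` each
entry is a finite sum). -/
def exp {R : Type*} [CommRing R] [Algebra ℚ R] (N : LowerTri R) : LowerTri R :=
  of fun k l => ∑ᶠ n : ℕ, (1 / (n.factorial : ℚ)) • (N ^ n).entry k l

/-- The logarithm series `∑_{n ≥ 1} (-1)ⁿ⁻¹ (A - 1)ⁿ / n`, summed entrywise (for lower triangular `A`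
with unit diagonal each entry is a finite sum). -/
def log {R : Type*} [CommRing R] [Algebra ℚ R] (A : LowerTri R) : LowerTri R :=
  of fun k l => ∑ᶠ n : ℕ, ((-1) ^ n / ((n : ℚ) + 1)) • ((A - 1) ^ (n + 1)).entry k l

lemma entry_eq_zero {R : Type*} [Zero R] (A : LowerTri R) {k l : ℕ} (h : k < l) :
    A.entry k l = 0 :=
  IncidenceAlgebra.apply_eq_zero_of_not_le (fun h' => absurd (OrderDual.toDual_le_toDual.1 h')
    (not_le.2 h)) A

lemma entry_of {R : Type*} [Zero R] (f : ℕ → ℕ → R) {k l : ℕ} (h : l ≤ k) :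
    (of f).entry k l = f k l := if_pos h

lemma entry_mul {R : Type*} [CommRing R] (A B : LowerTri R) (k l : ℕ) :
    (A * B).entry k l = ∑ j ∈ Finset.Icc l k, A.entry k j * B.entry j l := by
  unfold entry
  rw [IncidenceAlgebra.mul_apply]
  rfl

/-- Powers of strictly lower triangular matrices vanish further and further below the diagonal. -/
lemma entry_pow_eq_zero {R : Type*} [CommRing R] {N : LowerTri R} (hN : ∀ k, N.entry k k = 0) :
    ∀ (n : ℕ) {k l : ℕ}, k < l + n → (N ^ n).entry k l = 0
  | 0, k, l, h => entry_eq_zero _ (by omega)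
  | n + 1, k, l, h => by
    rw [pow_succ, entry_mul]
    refine Finset.sum_eq_zero fun j hj => ?_
    rw [Finset.mem_Icc] at hj
    by_cases hjl : j = l
    · rw [hjl, hN, mul_zero]
    · rw [entry_pow_eq_zero hN n (by omega), zero_mul]

/-- Each entry of the exponential of a strictly lower triangular matrix is a finite sum. -/
lemma entry_exp {R : Type*} [CommRing R] [Algebra ℚ R] {N : LowerTri R}
    (hN : ∀ k, N.entry k k = 0) {k l : ℕ} (h : l ≤ k) :
    N.exp.entry k l =
      ∑ n ∈ Finset.range (k + 1), (1 / (n.factorial : ℚ)) • (N ^ n).entry k l := by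
  rw [exp, entry_of _ h]
  refine finsum_eq_sum_of_support_subset _ fun n hn => ?_
  by_contra hn'
  refine hn ?_
  simp only [Finset.coe_range, Set.mem_Iio, not_lt] at hn'
  simp only [entry_pow_eq_zero hN n (show k < l + n by omega), smul_zero]

/-- Each entry of the logarithm of a unitriangular matrix is a finite sum. -/
lemma entry_log {R : Type*} [CommRing R] [Algebra ℚ R] {A : LowerTri R}
    (hA : ∀ k, (A - 1).entry k k = 0) {k l : ℕ} (h : l ≤ k) :
    A.log.entry k l = ∑ n ∈ Finset.range (k + 1),
      ((-1) ^ n / ((n : ℚ) + 1)) • ((A - 1) ^ (n + 1)).entry k l := by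
  rw [log, entry_of _ h]
  refine finsum_eq_sum_of_support_subset _ fun n hn => ?_
  by_contra hn'
  refine hn ?_
  simp only [Finset.coe_range, Set.mem_Iio, not_lt] at hn'
  simp only [entry_pow_eq_zero hA (n + 1) (show k < l + (n + 1) by omega), smul_zero]

end LowerTri

/-- The matrix `M` with entries `M_{k,l} = binom(l, k - l)` for `k ≥ l ≥ 1`. Rows and columns are
numbered from `0` here, so `entry k l` is `M_{k+1,l+1}`. -/
def riordanM (R : Type*) [CommRing R] : LowerTri R :=
  LowerTri.of fun k l => (((l + 1).choose ((k + 1) - (l + 1)) : ℕ) : R)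

end

noncomputable section

/-! The morphism is found by counting. Call a map `c` from the points of a noncrossing partition to
`N` colors `0, …, N - 1` a level coloring if two points share a block exactly when they have the
same color and no point between them has a smaller one. The number `numLevel` of such colorings
turns out to be a polynomial in `N`, and this polynomial is the image of the partition.

Each axiom is then a counting identity. With `N + M` colors, the blocks of color at least `N` form
an ideal; the remaining blocks are colored with `N` colors and the components of the ideal are
colored independently with `M` colors (`numLevel_add`). With `N * M` colors, write each color in
base `M`: the quotients are a level coloring of a unique fused partition and the remainders color
each class (`numLevel_mul`). The counits correspond to zero colors and one color. Polynomiality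
follows from `numLevel_add` with `M = 1`, which expresses the first difference through counts for
partitions with fewer blocks. Uniqueness holds because the first coproduct determines the value at
`n + 1` from the values at `n` and `1`, while the counits fix the values at `0` and `1`.

A nesting-free partition with `n` blocks is counted like `n` singletons
(`NCPartition.NestingFree.numLevel_eq`), so its colorings are the words of length `n` in which two
equal letters are always separated by a smaller one. Deleting the largest color removes a set
without consecutive elements, and there are `binom(l + 1, n - l)` such sets leaving `l` points.
Hence adding a color multiplies the vector of counts by `M`, and the counts for `N` colors form the
first column of `M ^ N` (`entry_riordanM_pow`).

It remains to interpolate the powers. The polynomials with value `(M ^ j)_{k,0}` at every `j`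
satisfy the linear differential system with matrix `ln M` (`derivative_powEntry`), and so does the
first column of `e^{X ln M}`; the initial values agree (`powEntry_eq_entry_exp`). -/

/-! ## Level colorings -/

/-- `x` and `y` lie in a common block of `S`. -/
def SameBlock (S : Finset (Finset ℕ)) (x y : ℕ) : Prop := ∃ b ∈ S, x ∈ b ∧ y ∈ b

/-- The blocks of `S` are the connected components of the level sets of `c` inside the
superlevel sets of `c`: two points are in the same block if and only if they have the same color
and no point between them has a smaller color. -/
def IsLevelColoring (S : Finset (Finset ℕ)) (c : ℕ → ℕ) : Prop :=
  ∀ x ∈ supp S, ∀ y ∈ supp S, x < y →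
    (SameBlock S x y ↔ c x = c y ∧ ∀ z ∈ supp S, x < z → z < y → c x ≤ c z)

/-- The colorings of `U` with `N` colors, extended by `0`. -/
def colorings (U : Finset ℕ) (N : ℕ) : Finset (ℕ →₀ ℕ) := U.finsupp fun _ => Finset.range N

open Classical in
/-- The colorings of `U` with `N` colors which satisfy `P`. -/
def coloringsWith (U : Finset ℕ) (N : ℕ) (P : (ℕ → ℕ) → Prop) : Finset (ℕ →₀ ℕ) :=
  (colorings U N).filter fun c : ℕ →₀ ℕ => P c

/-- The colorings with `N` colors of the support of `S` whose level partition is `S`. -/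
def levelColorings (S : Finset (Finset ℕ)) (N : ℕ) : Finset (ℕ →₀ ℕ) :=
  coloringsWith (supp S) N (IsLevelColoring S)

/-- The number of level colorings of `S` with `N` colors. -/
def numLevel (S : Finset (Finset ℕ)) (N : ℕ) : ℕ := (levelColorings S N).card

/-- The function `f` on `U`, extended by `0`. -/
def extendZero (U : Finset ℕ) (f : ℕ → ℕ) : ℕ →₀ ℕ :=
  Finsupp.onFinset U (fun x => if x ∈ U then f x else 0) fun x hx => by
    by_contra h; simp [h] at hx

lemma extendZero_apply {U : Finset ℕ} {f : ℕ → ℕ} {x : ℕ} (hx : x ∈ U) :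
    extendZero U f x = f x := by simp [extendZero, hx]

lemma extendZero_apply_of_notMem {U : Finset ℕ} {f : ℕ → ℕ} {x : ℕ} (hx : x ∉ U) :
    extendZero U f x = 0 := by simp [extendZero, hx]

lemma mem_colorings {U : Finset ℕ} {N : ℕ} {c : ℕ →₀ ℕ} :
    c ∈ colorings U N ↔ (∀ x, x ∉ U → c x = 0) ∧ ∀ x ∈ U, c x < N := by
  simp only [colorings, Finset.mem_finsupp_iff, Finset.mem_range]
  refine and_congr_left fun _ => ⟨fun h x hx => ?_, fun h x hx => ?_⟩
  · by_contra h'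
    exact hx (h (Finsupp.mem_support_iff.2 h'))
  · by_contra h'
    exact Finsupp.mem_support_iff.1 hx (h x h')

lemma extendZero_mem_colorings {U : Finset ℕ} {N : ℕ} {f : ℕ → ℕ} :
    extendZero U f ∈ colorings U N ↔ ∀ x ∈ U, f x < N := by
  rw [mem_colorings]
  refine ⟨fun h x hx => extendZero_apply (f := f) hx ▸ h.2 x hx, fun h => ⟨fun x hx => ?_, ?_⟩⟩
  · exact extendZero_apply_of_notMem hx
  · intro x hx
    rw [extendZero_apply hx]
    exact h x hx

lemma colorings_ext {U : Finset ℕ} {N M : ℕ} {c d : ℕ →₀ ℕ} (hc : c ∈ colorings U N)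
    (hd : d ∈ colorings U M) (h : ∀ x ∈ U, c x = d x) : c = d := by
  ext x
  by_cases hx : x ∈ U
  · exact h x hx
  · rw [(mem_colorings.1 hc).1 x hx, (mem_colorings.1 hd).1 x hx]

lemma mem_coloringsWith {U : Finset ℕ} {N : ℕ} {P : (ℕ → ℕ) → Prop} {c : ℕ →₀ ℕ} :
    c ∈ coloringsWith U N P ↔ c ∈ colorings U N ∧ P c := by
  simp [coloringsWith]

lemma mem_levelColorings {S : Finset (Finset ℕ)} {N : ℕ} {c : ℕ →₀ ℕ} :
    c ∈ levelColorings S N ↔ c ∈ colorings (supp S) N ∧ IsLevelColoring S c :=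
  mem_coloringsWith

lemma SameBlock.symm {S : Finset (Finset ℕ)} {x y : ℕ} : SameBlock S x y → SameBlock S y x :=
  fun ⟨b, hb, hx, hy⟩ => ⟨b, hb, hy, hx⟩

lemma sameBlock_self {S : Finset (Finset ℕ)} {x : ℕ} (hx : x ∈ supp S) : SameBlock S x x := by
  obtain ⟨b, hb, hxb⟩ := mem_supp.1 hx
  exact ⟨b, hb, hxb, hxb⟩

lemma IsLevelColoring.congr {S : Finset (Finset ℕ)} {c d : ℕ → ℕ}
    (h : ∀ x ∈ supp S, c x = d x) (hc : IsLevelColoring S c) : IsLevelColoring S d := by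
  intro x hx y hy hxy
  rw [hc x hx y hy hxy, h x hx, h y hy]
  refine and_congr_right fun _ => forall₂_congr fun z hz => ?_
  rw [h z hz]

lemma isLevelColoring_congr {S : Finset (Finset ℕ)} {c d : ℕ → ℕ}
    (h : ∀ x ∈ supp S, c x = d x) : IsLevelColoring S c ↔ IsLevelColoring S d :=
  ⟨.congr h, .congr fun x hx => (h x hx).symm⟩

lemma isLevelColoring_extendZero {S : Finset (Finset ℕ)} {f : ℕ → ℕ} :
    IsLevelColoring S (extendZero (supp S) f) ↔ IsLevelColoring S f :=
  isLevelColoring_congr fun _ hx => extendZero_apply hx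

/-- The map `r` is only weakly increasing, so that it may collapse points as well as relabel them.
By `hs`, points with the same image lie in a common block. -/
lemma isLevelColoring_comp_iff {S T : Finset (Finset ℕ)} {r : ℕ → ℕ}
    (hr : ∀ x ∈ supp S, ∀ y ∈ supp S, x ≤ y → r x ≤ r y) (him : (supp S).image r = supp T)
    (hs : ∀ x ∈ supp S, ∀ y ∈ supp S, (SameBlock S x y ↔ SameBlock T (r x) (r y)))
    (d : ℕ → ℕ) : IsLevelColoring S (d ∘ r) ↔ IsLevelColoring T d := by
  have hmem : ∀ {x}, x ∈ supp S → r x ∈ supp T := fun hx => him ▸ Finset.mem_image_of_mem r hx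
  have hlt : ∀ {x y}, x ∈ supp S → y ∈ supp S → r x < r y → x < y := fun hx hy h => by
    by_contra! h'
    exact absurd (hr _ hy _ hx h') (by omega)
  -- Only points sent strictly between `r x` and `r y` matter: a point sent to an endpoint has that
  -- endpoint's color, which is harmless once the endpoint colors agree. If they disagree, both
  -- level conditions fail anyway.
  have key : ∀ x ∈ supp S, ∀ y ∈ supp S, r x < r y →
      ((∀ z ∈ supp S, x < z → z < y → (d ∘ r) x ≤ (d ∘ r) z) ↔
        ∀ w ∈ supp T, r x < w → w < r y → d (r x) ≤ d w ∨ d (r x) ≠ d (r y)) ∨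
        d (r x) ≠ d (r y) := by
    intro x hx y hy hxy
    by_cases hd : d (r x) = d (r y)
    · left
      constructor
      · intro h w hw hxw hwy
        rw [← him, Finset.mem_image] at hw
        obtain ⟨z, hz, rfl⟩ := hw
        exact Or.inl (h z hz (hlt hx hz hxw) (hlt hz hy hwy))
      · intro h z hz hxz hzy
        rcases (hr x hx z hz hxz.le).lt_or_eq with h1 | h1
        · rcases (hr z hz y hy hzy.le).lt_or_eq with h2 | h2
          · exact (h (r z) (hmem hz) h1 h2).resolve_right (by simpa using hd)
          · simp [h2, hd]
        · simp [h1]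
    · exact Or.inr hd
  constructor
  · intro h v hv w hw hvw
    rw [← him, Finset.mem_image] at hv hw
    obtain ⟨x, hx, rfl⟩ := hv
    obtain ⟨y, hy, rfl⟩ := hw
    rw [← hs x hx y hy, h x hx y hy (hlt hx hy hvw)]
    rcases key x hx y hy hvw with h' | h'
    · refine and_congr_right fun hd => h'.trans ?_
      simp only [Function.comp] at hd
      simp [hd]
    · simp [h']
  · intro h x hx y hy hxy
    rcases (hr x hx y hy hxy.le).lt_or_eq with h1 | h1
    · rw [hs x hx y hy, h _ (hmem hx) _ (hmem hy) h1]
      rcases key x hx y hy h1 with h' | h'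
      · refine and_congr_right fun hd => Iff.trans ?_ h'.symm
        simp [hd]
      · simp [h']
    · rw [hs x hx y hy, h1]
      refine iff_of_true (sameBlock_self (hmem hy)) ⟨by simp [h1], fun z hz hxz hzy => ?_⟩
      have h2 := hr x hx z hz hxz.le
      have h3 := hr z hz y hy hzy.le
      have : r x = r z := by omega
      simp [this]

/-- The number of level colorings only depends on the relative position of the blocks. -/
theorem numLevel_eq_of_monotoneOn {S T : Finset (Finset ℕ)} (r : ℕ → ℕ)
    (hr : ∀ x ∈ supp S, ∀ y ∈ supp S, x ≤ y → r x ≤ r y) (him : (supp S).image r = supp T)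
    (hs : ∀ x ∈ supp S, ∀ y ∈ supp S, (SameBlock S x y ↔ SameBlock T (r x) (r y))) (N : ℕ) :
    numLevel S N = numLevel T N := by
  have hmem : ∀ {x}, x ∈ supp S → r x ∈ supp T := fun hx => him ▸ Finset.mem_image_of_mem r hx
  symm
  unfold numLevel
  refine Finset.card_bij (fun d _ => extendZero (supp S) (d ∘ r)) ?_ ?_ ?_
  · intro d hd
    rw [mem_levelColorings] at hd ⊢
    rw [extendZero_mem_colorings, isLevelColoring_extendZero, isLevelColoring_comp_iff hr him hs]
    exact ⟨fun x hx => (mem_colorings.1 hd.1).2 _ (hmem hx), hd.2⟩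
  · intro d hd e he h
    rw [mem_levelColorings] at hd he
    refine colorings_ext hd.1 he.1 fun w hw => ?_
    rw [← him, Finset.mem_image] at hw
    obtain ⟨x, hx, rfl⟩ := hw
    simpa [extendZero_apply hx] using DFunLike.congr_fun h x
  · intro c hc
    rw [mem_levelColorings] at hc
    -- Surjectivity: each fiber of `r` lies in one block, where a level coloring is constant, so `c`
    -- descends to `supp T` through any section `s` of `r`.
    have hsec : ∀ w, ∃ x, w ∈ supp T → x ∈ supp S ∧ r x = w := fun w => by
      by_cases hw : w ∈ supp T
      · rw [← him, Finset.mem_image] at hw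
        obtain ⟨x, hx⟩ := hw
        exact ⟨x, fun _ => hx⟩
      · exact ⟨0, fun h => absurd h hw⟩
    choose s hsS using hsec
    have hconst : ∀ x ∈ supp S, ∀ y ∈ supp S, r x = r y → c x = c y := by
      intro x hx y hy hxy
      have hb : SameBlock S x y := by
        rw [hs x hx y hy, hxy]
        exact sameBlock_self (hmem hy)
      rcases lt_trichotomy x y with h | h | h
      · exact ((hc.2 x hx y hy h).1 hb).1
      · rw [h]
      · exact ((hc.2 y hy x hx h).1 hb.symm).1.symm
    have heq : ∀ x ∈ supp S, c (s (r x)) = c x := fun x hx =>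
      hconst _ (hsS _ (hmem hx)).1 _ hx (hsS _ (hmem hx)).2
    refine ⟨extendZero (supp T) (c ∘ s), ?_, ?_⟩
    · rw [mem_levelColorings, extendZero_mem_colorings, isLevelColoring_extendZero,
        ← isLevelColoring_comp_iff hr him hs]
      exact ⟨fun w hw => (mem_colorings.1 hc.1).2 _ (hsS w hw).1,
        hc.2.congr fun x hx => (heq x hx).symm⟩
    · have : ∀ x ∈ supp S, (extendZero (supp T) (c ∘ s)) (r x) = c x := fun x hx => by
        rw [extendZero_apply (hmem hx)]
        exact heq x hx
      refine colorings_ext (N := N) (extendZero_mem_colorings.2 fun x hx => ?_) hc.1 fun x hx => ?_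
      · rw [Function.comp, this x hx]
        exact (mem_colorings.1 hc.1).2 x hx
      · rw [extendZero_apply hx]
        exact this x hx

lemma supp_standardize (S : Finset (Finset ℕ)) :
    (supp S).image (rankIn (supp S)) = supp (standardize S) := by
  ext r
  simp only [mem_supp, standardize, Finset.mem_image]
  constructor
  · rintro ⟨x, ⟨b, hb, hx⟩, rfl⟩
    exact ⟨_, ⟨b, hb, rfl⟩, Finset.mem_image_of_mem _ hx⟩
  · rintro ⟨_, ⟨b, hb, rfl⟩, hr⟩
    obtain ⟨x, hx, rfl⟩ := Finset.mem_image.1 hr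
    exact ⟨x, ⟨b, hb, hx⟩, rfl⟩

theorem numLevel_standardize (S : Finset (Finset ℕ)) (N : ℕ) :
    numLevel (standardize S) N = numLevel S N := by
  refine (numLevel_eq_of_monotoneOn (rankIn (supp S)) ?_ (supp_standardize S) ?_ N).symm
  · intro x hx y hy hxy
    rcases hxy.lt_or_eq with h | rfl
    · exact (rankIn_lt hy h).le
    · exact le_rfl
  · intro x hx y hy
    constructor
    · rintro ⟨b, hb, hxb, hyb⟩
      exact ⟨_, Finset.mem_image_of_mem _ hb, Finset.mem_image_of_mem _ hxb,
        Finset.mem_image_of_mem _ hyb⟩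
    · rintro ⟨_, hb', hxb, hyb⟩
      obtain ⟨b, hb, rfl⟩ := Finset.mem_image.1 hb'
      have : ∀ {w}, w ∈ supp S → rankIn (supp S) w ∈ b.image (rankIn (supp S)) → w ∈ b := by
        intro w hw h
        obtain ⟨v, hv, hvw⟩ := Finset.mem_image.1 h
        rwa [← rankIn_injOn _ (mem_supp.2 ⟨b, hb, hv⟩) hw hvw]
      exact ⟨b, hb, this hx hxb, this hy hyb⟩

/-! ## Colorings of disjoint unions -/

lemma card_coloringsWith_union {V W : Finset ℕ} (h : Disjoint V W) (N : ℕ)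
    {P Q : (ℕ → ℕ) → Prop} (hP : ∀ c d, (∀ x ∈ V, c x = d x) → (P c ↔ P d))
    (hQ : ∀ c d, (∀ x ∈ W, c x = d x) → (Q c ↔ Q d)) :
    (coloringsWith (V ∪ W) N fun c => P c ∧ Q c).card =
      (coloringsWith V N fun c => P c).card * (coloringsWith W N fun c => Q c).card := by
  rw [← Finset.card_product]
  have hW : ∀ {x}, x ∈ W → x ∉ V := fun hx hx' => Finset.disjoint_left.1 h hx' hx
  refine Finset.card_nbij' (fun c => (extendZero V c, extendZero W c))
    (fun p => extendZero (V ∪ W) fun x => if x ∈ V then p.1 x else p.2 x) ?_ ?_ ?_ ?_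
  · intro c hc
    simp only [Finset.mem_coe, Finset.mem_product, mem_coloringsWith,
      extendZero_mem_colorings] at hc ⊢
    refine ⟨⟨fun x hx => (mem_colorings.1 hc.1).2 x (by simp [hx]), ?_⟩,
      fun x hx => (mem_colorings.1 hc.1).2 x (by simp [hx]), ?_⟩
    · exact (hP _ _ fun x hx => extendZero_apply hx).2 hc.2.1
    · exact (hQ _ _ fun x hx => extendZero_apply hx).2 hc.2.2
  · intro p hp
    simp only [Finset.mem_coe, Finset.mem_product, mem_coloringsWith,
      extendZero_mem_colorings] at hp ⊢
    refine ⟨fun x hx => ?_, ?_, ?_⟩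
    · split_ifs with hV
      · exact (mem_colorings.1 hp.1.1).2 x hV
      · exact (mem_colorings.1 hp.2.1).2 x ((Finset.mem_union.1 hx).resolve_left hV)
    · refine (hP _ _ fun x hx => ?_).2 hp.1.2
      rw [extendZero_apply (by simp [hx]), if_pos hx]
    · refine (hQ _ _ fun x hx => ?_).2 hp.2.2
      rw [extendZero_apply (by simp [hx]), if_neg (hW hx)]
  · intro c hc
    simp only [Finset.mem_coe, mem_coloringsWith] at hc
    refine colorings_ext (N := N) (extendZero_mem_colorings.2 fun x hx => ?_) hc.1 fun x hx => ?_
    · split_ifs with hV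
      · rw [extendZero_apply hV]; exact (mem_colorings.1 hc.1).2 x hx
      · rw [extendZero_apply ((Finset.mem_union.1 hx).resolve_left hV)]
        exact (mem_colorings.1 hc.1).2 x hx
    · rw [extendZero_apply hx]
      split_ifs with hV
      · rw [extendZero_apply hV]
      · rw [extendZero_apply ((Finset.mem_union.1 hx).resolve_left hV)]
  · intro p hp
    simp only [Finset.mem_coe, Finset.mem_product, mem_coloringsWith] at hp
    refine Prod.ext ?_ ?_
    · refine colorings_ext (N := N) (extendZero_mem_colorings.2 fun x hx => ?_) hp.1.1
        fun x hx => ?_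
      · rw [extendZero_apply (by simp [hx]), if_pos hx]; exact (mem_colorings.1 hp.1.1).2 x hx
      · rw [extendZero_apply hx, extendZero_apply (by simp [hx]), if_pos hx]
    · refine colorings_ext (N := N) (extendZero_mem_colorings.2 fun x hx => ?_) hp.2.1
        fun x hx => ?_
      · rw [extendZero_apply (by simp [hx]), if_neg (hW hx)]
        exact (mem_colorings.1 hp.2.1).2 x hx
      · rw [extendZero_apply hx, extendZero_apply (by simp [hx]), if_neg (hW hx)]

lemma card_coloringsWith_biUnion {ι : Type*} [DecidableEq ι] (s : Finset ι) (V : ι → Finset ℕ)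
    (hV : (s : Set ι).PairwiseDisjoint V) (N : ℕ) (P : ι → (ℕ → ℕ) → Prop)
    (hP : ∀ i ∈ s, ∀ c d, (∀ x ∈ V i, c x = d x) → (P i c ↔ P i d)) :
    (coloringsWith (s.biUnion V) N fun c => ∀ i ∈ s, P i c).card =
      ∏ i ∈ s, (coloringsWith (V i) N fun c => P i c).card := by
  induction s using Finset.induction_on with
  | empty =>
    simp [coloringsWith, colorings, Finset.card_finsupp]
  | insert a s ha ih =>
    rw [Finset.prod_insert ha, ← ih (hV.subset (by simp)) fun i hi => hP i (by simp [hi]),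
      Finset.biUnion_insert]
    simp only [Finset.mem_insert, forall_eq_or_imp]
    refine card_coloringsWith_union (P := P a) (Q := fun c => ∀ i ∈ s, P i c) ?_ N
      (hP a (by simp)) fun c d h => ?_
    · rw [Finset.disjoint_biUnion_right]
      intro i hi
      exact hV (by simp) (by simp [hi]) fun h => ha (h ▸ hi)
    · refine forall₂_congr fun i hi => hP i (by simp [hi]) c d fun x hx => h x ?_
      exact Finset.mem_biUnion.2 ⟨i, hi, hx⟩

/-! ## Splitting off the large colors -/

lemma IsBlockFamily.eq_of_mem {S : Finset (Finset ℕ)} (hS : IsBlockFamily S) {b b' : Finset ℕ}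
    (hb : b ∈ S) (hb' : b' ∈ S) {x : ℕ} (hx : x ∈ b) (hx' : x ∈ b') : b = b' := by
  by_contra h
  exact Finset.disjoint_left.1 (hS.2 hb hb' h) hx hx'

lemma IsBlockFamily.mono {S T : Finset (Finset ℕ)} (hS : IsBlockFamily S) (h : T ⊆ S) :
    IsBlockFamily T :=
  ⟨fun h' => hS.1 (h h'), hS.2.subset (by exact_mod_cast h)⟩

lemma IsNoncrossing.mono {S T : Finset (Finset ℕ)} (hS : IsNoncrossing S) (h : T ⊆ S) :
    IsNoncrossing T :=
  fun b hb b' hb' => hS b (h hb) b' (h hb')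

lemma supp_mono {S T : Finset (Finset ℕ)} (h : T ⊆ S) : supp T ⊆ supp S :=
  Finset.sup_mono h

lemma IsBlockFamily.mem_supp_sdiff {S J : Finset (Finset ℕ)} (hS : IsBlockFamily S) (hJ : J ⊆ S)
    {x : ℕ} : x ∈ supp (S \ J) ↔ x ∈ supp S ∧ x ∉ supp J := by
  simp only [mem_supp, Finset.mem_sdiff]
  constructor
  · rintro ⟨b, ⟨hb, hbJ⟩, hx⟩
    refine ⟨⟨b, hb, hx⟩, ?_⟩
    rintro ⟨b', hb', hx'⟩
    exact hbJ (hS.eq_of_mem hb (hJ hb') hx hx' ▸ hb')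
  · rintro ⟨⟨b, hb, hx⟩, h⟩
    exact ⟨b, ⟨hb, fun hbJ => h ⟨b, hbJ, hx⟩⟩, hx⟩

lemma IsBlockFamily.sameBlock_iff_of_subset {S T : Finset (Finset ℕ)} (hS : IsBlockFamily S)
    (hT : T ⊆ S) {x y : ℕ} (hx : x ∈ supp T) : SameBlock T x y ↔ SameBlock S x y := by
  refine ⟨fun ⟨b, hb, h⟩ => ⟨b, hT hb, h⟩, fun ⟨b, hb, h⟩ => ⟨b, ?_, h⟩⟩
  obtain ⟨b', hb', hxb'⟩ := mem_supp.1 hx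
  rwa [hS.eq_of_mem hb (hT hb') h.1 hxb']

lemma IsLevelColoring.eq_of_sameBlock {S : Finset (Finset ℕ)} {c : ℕ → ℕ}
    (hc : IsLevelColoring S c) {x y : ℕ} (h : SameBlock S x y) : c x = c y := by
  have hx : x ∈ supp S := mem_supp.2 (h.imp fun b hb => ⟨hb.1, hb.2.1⟩)
  have hy : y ∈ supp S := mem_supp.2 (h.imp fun b hb => ⟨hb.1, hb.2.2⟩)
  rcases lt_trichotomy x y with h' | h' | h'
  · exact ((hc x hx y hy h').1 h).1
  · rw [h']
  · exact ((hc y hy x hx h').1 h.symm).1.symm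

lemma IsLevelColoring.le_of_sameBlock {S : Finset (Finset ℕ)} {c : ℕ → ℕ}
    (hc : IsLevelColoring S c) {x y z : ℕ} (h : SameBlock S x y) (hz : z ∈ supp S)
    (hz' : z ∈ Finset.uIcc x y) : c x ≤ c z := by
  have hx : x ∈ supp S := mem_supp.2 (h.imp fun b hb => ⟨hb.1, hb.2.1⟩)
  have hy : y ∈ supp S := mem_supp.2 (h.imp fun b hb => ⟨hb.1, hb.2.2⟩)
  have hxy := hc.eq_of_sameBlock h
  rw [Finset.mem_uIcc] at hz'
  by_cases h1 : z = x
  · rw [h1]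
  by_cases h2 : z = y
  · rw [h2, hxy]
  rcases lt_trichotomy x y with h' | h' | h'
  · exact ((hc x hx y hy h').1 h).2 z hz (by omega) (by omega)
  · omega
  · rw [hxy]; exact ((hc y hy x hx h').1 h.symm).2 z hz (by omega) (by omega)

/-! ### Connected components of a finite set of integers. -/

lemma mem_component {U : Finset ℕ} {x y : ℕ} :
    y ∈ component U x ↔ y ∈ U ∧ Finset.uIcc x y ⊆ U := Finset.mem_filter

lemma mem_component_self {U : Finset ℕ} {x : ℕ} (hx : x ∈ U) : x ∈ component U x := by
  simp [mem_component, hx]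

lemma component_subset (U : Finset ℕ) (x : ℕ) : component U x ⊆ U := Finset.filter_subset _ _

lemma component_eq_of_mem {U : Finset ℕ} {x y : ℕ} (h : y ∈ component U x) :
    component U y = component U x := by
  rw [mem_component] at h
  ext z
  simp only [mem_component]
  refine and_congr_right fun hz => ⟨fun h' w hw => ?_, fun h' w hw => ?_⟩
  all_goals
    have h1 := @h.2 w
    have h2 := @h' w
    rw [Finset.mem_uIcc] at *
    by_cases hwy : w ∈ Finset.uIcc x y
    · exact h.2 hwy
    · refine h' ?_
      rw [Finset.mem_uIcc] at *
      omega

lemma mem_components {U C : Finset ℕ} : C ∈ components U ↔ ∃ x ∈ U, component U x = C :=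
  Finset.mem_image

lemma component_eq_of_mem_components {U C : Finset ℕ} {x : ℕ} (hC : C ∈ components U)
    (hx : x ∈ C) : C = component U x := by
  obtain ⟨y, hy, rfl⟩ := mem_components.1 hC
  exact (component_eq_of_mem hx).symm

lemma component_mem_components {U : Finset ℕ} {x : ℕ} (hx : x ∈ U) :
    component U x ∈ components U := Finset.mem_image_of_mem _ hx

lemma biUnion_components (U : Finset ℕ) : (components U).biUnion id = U := by
  ext x
  simp only [Finset.mem_biUnion, id]
  constructor
  · rintro ⟨C, hC, hx⟩
    rw [component_eq_of_mem_components hC hx] at hx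
    exact component_subset _ _ hx
  · exact fun hx => ⟨_, component_mem_components hx, mem_component_self hx⟩

/-! ### Ideals as sets of blocks of large color. -/

namespace IsNCIdeal

variable {π : NCPartition} {J : Finset (Finset ℕ)}

lemma subset_component (hJ : IsNCIdeal π J) {b : Finset ℕ} (hb : b ∈ J) {x : ℕ} (hx : x ∈ b) :
    b ⊆ component (supp J) x := by
  have hxJ : x ∈ supp J := mem_supp.2 ⟨b, hb, hx⟩
  obtain ⟨T, hT, hTC⟩ := hJ.2 _ (component_mem_components hxJ)
  obtain ⟨b', hb', hxb'⟩ := mem_supp.1 (hTC ▸ mem_component_self hxJ)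
  rw [π.2.2.1.eq_of_mem (hJ.1 hb) (hT hb') hx hxb', ← hTC]
  exact fun y hy => mem_supp.2 ⟨b', hb', hy⟩

lemma supp_filter (hJ : IsNCIdeal π J) {C : Finset ℕ} (hC : C ∈ components (supp J)) :
    supp (J.filter (· ⊆ C)) = C := by
  ext x
  rw [mem_supp]
  constructor
  · rintro ⟨b, hb, hx⟩
    exact (Finset.mem_filter.1 hb).2 hx
  · intro hx
    have hCx := component_eq_of_mem_components hC hx
    obtain ⟨b, hb, hxb⟩ := mem_supp.1 (component_subset _ _ (hCx ▸ hx))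
    exact ⟨b, Finset.mem_filter.2 ⟨hb, hCx ▸ hJ.subset_component hb hxb⟩, hxb⟩

/-- For two low points, the points of `J` between them are irrelevant because their colors are
larger. For two points of one component, everything between them lies in that component. Any other
pair fails both sides: it has one low and one high point, or two high points in different
components, hence separated by a low point. -/
lemma isLevelColoring_iff (hJ : IsNCIdeal π J) {N : ℕ} {c : ℕ → ℕ} (h1 : ∀ x ∈ supp J, N ≤ c x)
    (h2 : ∀ x ∈ supp (π.blocks \ J), c x < N) :
    IsLevelColoring π.blocks c ↔ IsLevelColoring (π.blocks \ J) c ∧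
      ∀ C ∈ components (supp J), IsLevelColoring (J.filter (· ⊆ C)) fun x => c x - N := by
  have hS : IsBlockFamily π.blocks := π.2.2.1
  have hmem : ∀ {x}, x ∈ supp (π.blocks \ J) ↔ x ∈ supp π.blocks ∧ x ∉ supp J :=
    hS.mem_supp_sdiff hJ.1
  have hJS : supp J ⊆ supp π.blocks := supp_mono hJ.1
  have hlow : ∀ x ∈ supp (π.blocks \ J), ∀ y ∈ supp (π.blocks \ J),
      ((SameBlock π.blocks x y ↔
          c x = c y ∧ ∀ z ∈ supp π.blocks, x < z → z < y → c x ≤ c z) ↔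
        (SameBlock (π.blocks \ J) x y ↔
          c x = c y ∧ ∀ z ∈ supp (π.blocks \ J), x < z → z < y → c x ≤ c z)) := by
    intro x hx y hy
    rw [hS.sameBlock_iff_of_subset Finset.sdiff_subset hx]
    refine iff_congr Iff.rfl (and_congr_right fun _ => ⟨fun h z hz => h z (hmem.1 hz).1, ?_⟩)
    intro h z hz hxz hzy
    by_cases hzJ : z ∈ supp J
    · exact (h2 x hx).le.trans (h1 z hzJ)
    · exact h z (hmem.2 ⟨hz, hzJ⟩) hxz hzy
  have hhigh : ∀ C ∈ components (supp J), ∀ x ∈ C, ∀ y ∈ C, x < y →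
      ((SameBlock π.blocks x y ↔
          c x = c y ∧ ∀ z ∈ supp π.blocks, x < z → z < y → c x ≤ c z) ↔
        (SameBlock (J.filter (· ⊆ C)) x y ↔
          c x - N = c y - N ∧ ∀ z ∈ C, x < z → z < y → c x - N ≤ c z - N)) := by
    intro C hC x hx y hy hxy
    have hsub : J.filter (· ⊆ C) ⊆ π.blocks := (Finset.filter_subset _ _).trans hJ.1
    have hCJ : ∀ {w}, w ∈ C → w ∈ supp J := fun hw => by
      rw [component_eq_of_mem_components hC hw] at hw
      exact component_subset _ _ hw
    have hCint : ∀ z, x < z → z < y → z ∈ C := by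
      intro z hxz hzy
      rw [component_eq_of_mem_components hC hx, mem_component] at hy ⊢
      refine ⟨hy.2 ?_, fun w hw => hy.2 ?_⟩ <;> rw [Finset.mem_uIcc] at * <;> omega
    rw [hS.sameBlock_iff_of_subset hsub ((hJ.supp_filter hC).symm ▸ hx)]
    have hx1 := h1 x (hCJ hx)
    have hy1 := h1 y (hCJ hy)
    refine iff_congr Iff.rfl (and_congr (by omega) ⟨fun h z hz hxz hzy => ?_,
      fun h z hz hxz hzy => ?_⟩)
    · have := h z (hJS (hCJ hz)) hxz hzy
      omega
    · have hzC := hCint z hxz hzy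
      have := h z hzC hxz hzy
      have := h1 z (hCJ hzC)
      omega
  constructor
  · refine fun h => ⟨fun x hx y hy hxy => (hlow x hx y hy).1
      (h x (hmem.1 hx).1 y (hmem.1 hy).1 hxy), fun C hC => ?_⟩
    intro x hx y hy hxy
    rw [hJ.supp_filter hC] at hx hy ⊢
    have hCJ : ∀ {w}, w ∈ C → w ∈ supp J := fun hw => by
      rw [component_eq_of_mem_components hC hw] at hw
      exact component_subset _ _ hw
    exact (hhigh C hC x hx y hy hxy).1 (h x (hJS (hCJ hx)) y (hJS (hCJ hy)) hxy)
  · rintro ⟨hl, hh⟩ x hx y hy hxy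
    by_cases hxJ : x ∈ supp J <;> by_cases hyJ : y ∈ supp J
    · by_cases hyx : y ∈ component (supp J) x
      · have hC := component_mem_components hxJ
        have hlev := hh _ hC
        rw [IsLevelColoring, hJ.supp_filter hC] at hlev
        have hxx := mem_component_self hxJ
        exact (hhigh _ hC x hxx y hyx hxy).2 (hlev x hxx y hyx hxy)
      · refine iff_of_false (fun ⟨b, hb, hxb, hyb⟩ => ?_) fun ⟨_, h⟩ => hyx ?_
        · obtain ⟨b', hb', hxb'⟩ := mem_supp.1 hxJ
          rw [hS.eq_of_mem hb (hJ.1 hb') hxb hxb'] at hyb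
          exact hyx (hJ.subset_component hb' hxb' hyb)
        · refine mem_component.2 ⟨hyJ, fun z hz => ?_⟩
          rw [Finset.mem_uIcc] at hz
          -- The support of `π` is an interval, so a gap of `supp J` between `x` and `y` is a point
          -- of `π` with color below `N`, smaller than the color of `x`.
          by_contra hzJ
          have hzx : z ≠ x := fun h => hzJ (h ▸ hxJ)
          have hzy : z ≠ y := fun h => hzJ (h ▸ hyJ)
          obtain ⟨n, hn⟩ := π.2.2.2.1
          change supp π.blocks = _ at hn
          have hzS : z ∈ supp π.blocks := by
            rw [hn, Finset.mem_Icc] at hx hy ⊢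
            omega
          have h3 := h z hzS (by omega) (by omega)
          have h4 := h2 z (hmem.2 ⟨hzS, hzJ⟩)
          have h5 := h1 x hxJ
          omega
    · refine iff_of_false (fun h => hyJ ?_) fun h => ?_
      · obtain ⟨b, hb, -, hyb⟩ := (hS.sameBlock_iff_of_subset hJ.1 hxJ).2 h
        exact mem_supp.2 ⟨b, hb, hyb⟩
      · have := h1 x hxJ
        have := h2 y (hmem.2 ⟨hy, hyJ⟩)
        omega
    · refine iff_of_false (fun h => hxJ ?_) fun h => ?_
      · obtain ⟨b, hb, -, hyb⟩ := (hS.sameBlock_iff_of_subset hJ.1 hyJ).2 h.symm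
        exact mem_supp.2 ⟨b, hb, hyb⟩
      · have := h1 y hyJ
        have := h2 x (hmem.2 ⟨hx, hxJ⟩)
        omega
    · have hx' := hmem.2 ⟨hx, hxJ⟩
      have hy' := hmem.2 ⟨hy, hyJ⟩
      exact (hlow x hx' y hy').2 (hl x hx' y hy' hxy)

end IsNCIdeal

/-- The blocks which meet the set of points of color at least `N`. -/
def highBlocks (S : Finset (Finset ℕ)) (N : ℕ) (c : ℕ → ℕ) : Finset (Finset ℕ) :=
  S.filter fun b => ∃ x ∈ b, N ≤ c x

lemma IsLevelColoring.mem_supp_highBlocks {S : Finset (Finset ℕ)} {c : ℕ → ℕ}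
    (hc : IsLevelColoring S c) {N x : ℕ} (hx : x ∈ supp S) :
    x ∈ supp (highBlocks S N c) ↔ N ≤ c x := by
  rw [mem_supp]
  constructor
  · rintro ⟨b, hb, hxb⟩
    obtain ⟨hb, y, hy, hyN⟩ := Finset.mem_filter.1 hb
    rwa [hc.eq_of_sameBlock ⟨b, hb, hxb, hy⟩]
  · intro h
    obtain ⟨b, hb, hxb⟩ := mem_supp.1 hx
    exact ⟨b, Finset.mem_filter.2 ⟨hb, x, hxb, h⟩, hxb⟩

/-- Between two points of a block no color is smaller than the color of the block. The whole
interval spanned by a high block is therefore high, and the block stays inside one component. -/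
lemma isNCIdeal_highBlocks {π : NCPartition} {N : ℕ} {c : ℕ → ℕ}
    (hc : IsLevelColoring π.blocks c) : IsNCIdeal π (highBlocks π.blocks N c) := by
  set J := highBlocks π.blocks N c with hJ
  have hJS : J ⊆ π.blocks := Finset.filter_subset _ _
  refine ⟨hJS, fun C hC => ⟨J.filter (· ⊆ C), (Finset.filter_subset _ _).trans hJS, ?_⟩⟩
  ext x
  rw [mem_supp]
  constructor
  · rintro ⟨b, hb, hx⟩
    exact (Finset.mem_filter.1 hb).2 hx
  · intro hx
    have hCx := component_eq_of_mem_components hC hx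
    have hxJ := component_subset _ _ (hCx ▸ hx)
    obtain ⟨b, hb, hxb⟩ := mem_supp.1 hxJ
    refine ⟨b, Finset.mem_filter.2 ⟨hb, fun w hw => ?_⟩, hxb⟩
    have hwJ : w ∈ supp J := mem_supp.2 ⟨b, hb, hw⟩
    rw [hCx, mem_component]
    refine ⟨hwJ, fun z hz => ?_⟩
    have hxS := supp_mono hJS hxJ
    have hwS := supp_mono hJS hwJ
    have hzS : z ∈ supp π.blocks := by
      obtain ⟨n, hn⟩ := π.2.2.2.1
      change supp π.blocks = _ at hn
      rw [hn, Finset.mem_Icc] at hxS hwS ⊢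
      rw [Finset.mem_uIcc] at hz
      omega
    rw [hc.mem_supp_highBlocks hzS]
    exact ((hc.mem_supp_highBlocks hxS).1 hxJ).trans
      (hc.le_of_sameBlock ⟨b, hJS hb, hxb, hw⟩ hzS hz)

lemma highBlocks_eq_iff {S J : Finset (Finset ℕ)} (hS : IsBlockFamily S) (hJ : J ⊆ S) {N : ℕ}
    {c : ℕ → ℕ} (hc : IsLevelColoring S c) :
    highBlocks S N c = J ↔ (∀ x ∈ supp J, N ≤ c x) ∧ ∀ x ∈ supp (S \ J), c x < N := by
  constructor
  · rintro rfl
    refine ⟨fun x hx => (hc.mem_supp_highBlocks (supp_mono hJ hx)).1 hx, fun x hx => ?_⟩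
    rw [hS.mem_supp_sdiff hJ] at hx
    rw [hc.mem_supp_highBlocks hx.1] at hx
    omega
  · rintro ⟨h1, h2⟩
    ext b
    rw [highBlocks, Finset.mem_filter]
    constructor
    · rintro ⟨hb, x, hx, hN⟩
      by_contra hbJ
      have := h2 x (mem_supp.2 ⟨b, Finset.mem_sdiff.2 ⟨hb, hbJ⟩, hx⟩)
      omega
    · intro hb
      obtain ⟨x, hx⟩ : b.Nonempty := by
        rw [Finset.nonempty_iff_ne_empty]
        rintro rfl
        exact hS.1 (hJ hb)
      exact ⟨hJ hb, x, hx, h1 x (mem_supp.2 ⟨b, hb, hx⟩)⟩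

/-- The bijection cuts a coloring into its restriction to the blocks outside `J` and its restriction
to `J`, shifted down by `N`. By `IsNCIdeal.isLevelColoring_iff` the two parts may be chosen
independently. -/
lemma card_highBlocks_fiber {π : NCPartition} {J : Finset (Finset ℕ)} (hJ : IsNCIdeal π J)
    (N M : ℕ) :
    ((levelColorings π.blocks (N + M)).filter fun c : ℕ →₀ ℕ =>
        highBlocks π.blocks N c = J).card =
      numLevel (π.blocks \ J) N * (coloringsWith (supp J) M fun c =>
        ∀ C ∈ components (supp J), IsLevelColoring (J.filter (· ⊆ C)) c).card := by
  have hS : IsBlockFamily π.blocks := π.2.2.1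
  have hmem : ∀ {x}, x ∈ supp (π.blocks \ J) ↔ x ∈ supp π.blocks ∧ x ∉ supp J :=
    hS.mem_supp_sdiff hJ.1
  have hJS : supp J ⊆ supp π.blocks := supp_mono hJ.1
  have hCJ : ∀ C ∈ components (supp J), ∀ x ∈ supp (J.filter (· ⊆ C)), x ∈ supp J :=
    fun C _ x hx => supp_mono (Finset.filter_subset _ _) hx
  rw [numLevel, ← Finset.card_product]
  refine Finset.card_nbij'
    (fun c => (extendZero (supp (π.blocks \ J)) c, extendZero (supp J) fun x => c x - N))
    (fun p => extendZero (supp π.blocks) fun x => if x ∈ supp J then p.2 x + N else p.1 x)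
    ?_ ?_ ?_ ?_
  · intro c hc
    simp only [Finset.mem_coe, Finset.mem_filter, mem_levelColorings, Finset.mem_product,
      mem_coloringsWith, extendZero_mem_colorings, isLevelColoring_extendZero] at hc ⊢
    obtain ⟨⟨hc1, hc2⟩, hc3⟩ := hc
    rw [highBlocks_eq_iff hS hJ.1 hc2] at hc3
    rw [hJ.isLevelColoring_iff hc3.1 hc3.2] at hc2
    refine ⟨⟨hc3.2, hc2.1⟩, fun x hx => ?_, fun C hC => ?_⟩
    · have := (mem_colorings.1 hc1).2 x (hJS hx)
      have := hc3.1 x hx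
      omega
    · exact (hc2.2 C hC).congr fun x hx => (extendZero_apply (hCJ C hC x hx)).symm
  · intro p hp
    simp only [Finset.mem_coe, Finset.mem_filter, mem_levelColorings, Finset.mem_product,
      mem_coloringsWith, extendZero_mem_colorings, isLevelColoring_extendZero] at hp ⊢
    obtain ⟨⟨hp1, hp2⟩, hp3, hp4⟩ := hp
    set f : ℕ → ℕ := fun x => if x ∈ supp J then p.2 x + N else p.1 x with hf
    have h1 : ∀ x ∈ supp J, N ≤ f x := fun x hx => by simp [hf, hx]
    have h2 : ∀ x ∈ supp (π.blocks \ J), f x < N := fun x hx => by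
      simp only [hf, if_neg (hmem.1 hx).2]
      exact (mem_colorings.1 hp1).2 x hx
    have hlev : IsLevelColoring π.blocks f := by
      rw [hJ.isLevelColoring_iff h1 h2]
      refine ⟨hp2.congr fun x hx => ?_, fun C hC => (hp4 C hC).congr fun x hx => ?_⟩
      · simp [hf, (hmem.1 hx).2]
      · simp [hf, hCJ C hC x hx]
    refine ⟨⟨fun x hx => ?_, hlev⟩, ?_⟩
    · by_cases hxJ : x ∈ supp J
      · have := (mem_colorings.1 hp3).2 x hxJ
        simp only [hxJ, if_true]
        omega
      · have := h2 x (hmem.2 ⟨hx, hxJ⟩)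
        simp only [hf] at this
        omega
    · rw [highBlocks_eq_iff hS hJ.1 (isLevelColoring_extendZero.2 hlev)]
      refine ⟨fun x hx => ?_, fun x hx => ?_⟩
      · rw [extendZero_apply (hJS hx)]
        exact h1 x hx
      · rw [extendZero_apply (hmem.1 hx).1]
        exact h2 x hx
  · intro c hc
    simp only [Finset.mem_coe, Finset.mem_filter, mem_levelColorings] at hc
    obtain ⟨⟨hc1, hc2⟩, hc3⟩ := hc
    rw [highBlocks_eq_iff hS hJ.1 hc2] at hc3
    have : ∀ x ∈ supp π.blocks, (if x ∈ supp J then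
        (extendZero (supp J) fun x => c x - N) x + N
        else (extendZero (supp (π.blocks \ J)) c) x) = c x := by
      intro x hx
      split_ifs with hxJ
      · rw [extendZero_apply hxJ]
        exact Nat.sub_add_cancel (hc3.1 x hxJ)
      · rw [extendZero_apply (hmem.2 ⟨hx, hxJ⟩)]
    refine colorings_ext (N := N + M) (extendZero_mem_colorings.2 fun x hx => ?_) hc1
      fun x hx => ?_
    · rw [this x hx]
      exact (mem_colorings.1 hc1).2 x hx
    · rw [extendZero_apply hx]
      exact this x hx
  · intro p hp
    simp only [Finset.mem_coe, mem_levelColorings, Finset.mem_product, mem_coloringsWith] at hp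
    have h1 : ∀ x ∈ supp (π.blocks \ J), (extendZero (supp π.blocks) fun x =>
        if x ∈ supp J then p.2 x + N else p.1 x) x = p.1 x := fun x hx => by
      rw [extendZero_apply (hmem.1 hx).1, if_neg (hmem.1 hx).2]
    have h2 : ∀ x ∈ supp J, (extendZero (supp π.blocks) fun x =>
        if x ∈ supp J then p.2 x + N else p.1 x) x - N = p.2 x := fun x hx => by
      rw [extendZero_apply (hJS hx), if_pos hx, Nat.add_sub_cancel]
    refine Prod.ext ?_ ?_
    · refine colorings_ext (N := N) (extendZero_mem_colorings.2 fun x hx => ?_) hp.1.1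
        fun x hx => ?_
      · rw [h1 x hx]; exact (mem_colorings.1 hp.1.1).2 x hx
      · rw [extendZero_apply hx, h1 x hx]
    · refine colorings_ext (N := M) (extendZero_mem_colorings.2 fun x hx => ?_) hp.2.1
        fun x hx => ?_
      · rw [h2 x hx]; exact (mem_colorings.1 hp.2.1).2 x hx
      · rw [extendZero_apply hx, h2 x hx]

open Classical in
/-- Level colorings with `N + M` colors, according to the blocks of color at least `N`. -/
theorem numLevel_add (π : NCPartition) (N M : ℕ) :
    numLevel π.blocks (N + M) = ∑ J ∈ π.blocks.powerset.filter (IsNCIdeal π),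
      numLevel (π.blocks \ J) N *
        ∏ C ∈ components (supp J), numLevel (J.filter (· ⊆ C)) M := by
  rw [numLevel, Finset.card_eq_sum_card_fiberwise (f := fun c : ℕ →₀ ℕ =>
    highBlocks π.blocks N c) (t := π.blocks.powerset.filter (IsNCIdeal π))]
  · refine Finset.sum_congr rfl fun J hJ => ?_
    have hJ := (Finset.mem_filter.1 hJ).2
    have key := card_coloringsWith_biUnion (components (supp J)) id ?_ M
      (fun C => IsLevelColoring (J.filter (· ⊆ C))) ?_
    · rw [biUnion_components] at key
      rw [card_highBlocks_fiber hJ, key]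
      congr 1
      refine Finset.prod_congr rfl fun C hC => ?_
      rw [numLevel, levelColorings, hJ.supp_filter hC]
      rfl
    · intro C hC D hD hCD
      refine Finset.disjoint_left.2 fun x hx hx' => hCD ?_
      rw [component_eq_of_mem_components hC hx, component_eq_of_mem_components hD hx']
    · intro C hC c d h
      refine isLevelColoring_congr fun x hx => h x ?_
      rwa [hJ.supp_filter hC] at hx
  · intro c hc
    have hc := (mem_levelColorings.1 hc).2
    simp only [Finset.coe_filter, Finset.mem_powerset]
    exact ⟨(isNCIdeal_highBlocks hc).1, isNCIdeal_highBlocks hc⟩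

/-! ## Lexicographic products of colors -/

section Fuse

variable {S : Finset (Finset ℕ)} (Q : Finpartition S)

lemma supp_fuse : supp (fuse Q) = supp S := by
  ext x
  simp only [mem_supp, fuse, Finset.mem_image, exists_exists_and_eq_and]
  constructor
  · rintro ⟨p, hp, b, hb, hx⟩
    exact ⟨b, Q.subset hp hb, hx⟩
  · rintro ⟨b, hb, hx⟩
    obtain ⟨p, hp, hbp⟩ := Q.exists_mem hb
    exact ⟨p, hp, b, hbp, hx⟩

lemma sameBlock_fuse {x y : ℕ} :
    SameBlock (fuse Q) x y ↔ ∃ p ∈ Q.parts, x ∈ supp p ∧ y ∈ supp p := by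
  simp [SameBlock, fuse]

variable {Q}

lemma IsBlockFamily.part_eq (hS : IsBlockFamily S) {p q : Finset (Finset ℕ)} (hp : p ∈ Q.parts)
    (hq : q ∈ Q.parts) {x : ℕ} (hxp : x ∈ supp p) (hxq : x ∈ supp q) : p = q := by
  obtain ⟨b, hb, hxb⟩ := mem_supp.1 hxp
  obtain ⟨b', hb', hxb'⟩ := mem_supp.1 hxq
  obtain rfl := hS.eq_of_mem (Q.subset hp hb) (Q.subset hq hb') hxb hxb'
  exact Q.eq_of_mem_parts hp hq hb hb'

lemma IsBlockFamily.fuse (hS : IsBlockFamily S) (Q : Finpartition S) :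
    IsBlockFamily (fuse Q) := by
  constructor
  · intro h
    obtain ⟨p, hp, hp'⟩ := Finset.mem_image.1 h
    obtain ⟨b, hb⟩ := Q.nonempty_of_mem_parts hp
    have hbS := Q.subset hp hb
    have hb0 : b = ∅ := Finset.subset_empty.1 (hp' ▸ fun x hx => mem_supp.2 ⟨b, hb, hx⟩)
    exact hS.1 (hb0 ▸ hbS)
  · intro d hd d' hd' hne
    obtain ⟨p, hp, rfl⟩ := Finset.mem_image.1 hd
    obtain ⟨q, hq, rfl⟩ := Finset.mem_image.1 hd'
    refine Finset.disjoint_left.2 fun x hx hx' => hne ?_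
    rw [hS.part_eq hp hq hx hx']

lemma IsBlockFamily.mem_part_iff (hS : IsBlockFamily S) {p : Finset (Finset ℕ)}
    (hp : p ∈ Q.parts) {b b' : Finset ℕ} (hb : b ∈ p) (hb' : b' ∈ S) {x y : ℕ} (hx : x ∈ b)
    (hy : y ∈ b') : b' ∈ p ↔ SameBlock (_root_.fuse Q) x y := by
  rw [sameBlock_fuse]
  constructor
  · exact fun h => ⟨p, hp, mem_supp.2 ⟨b, hb, hx⟩, mem_supp.2 ⟨b', h, hy⟩⟩
  · rintro ⟨q, hq, hxq, hyq⟩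
    obtain rfl := hS.part_eq hp hq (mem_supp.2 ⟨b, hb, hx⟩) hxq
    obtain ⟨b'', hb'', hy''⟩ := mem_supp.1 hyq
    rwa [hS.eq_of_mem hb' (Q.subset hp hb'') hy hy'']

lemma IsBlockFamily.nonempty_of_mem (hS : IsBlockFamily S) {b : Finset ℕ} (hb : b ∈ S) :
    b.Nonempty := by
  rw [Finset.nonempty_iff_ne_empty]
  rintro rfl
  exact hS.1 hb

/-- Blocks are nonempty and disjoint, so whether two of them are equivalent can be tested on one
point of each. Thus `Q` can be read off from the fused partition. -/
lemma IsBlockFamily.parts_subset_of_sameBlock_fuse (hS : IsBlockFamily S) {Q Q' : Finpartition S}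
    (h : ∀ x ∈ supp S, ∀ y ∈ supp S,
      (SameBlock (_root_.fuse Q) x y ↔ SameBlock (_root_.fuse Q') x y)) :
    Q.parts ⊆ Q'.parts := by
  intro p hp
  obtain ⟨b, hb⟩ := Q.nonempty_of_mem_parts hp
  have hbS := Q.subset hp hb
  obtain ⟨p', hp', hbp'⟩ := Q'.exists_mem hbS
  have : p = p' := by
    ext b'
    by_cases hb' : b' ∈ S
    · obtain ⟨x, hx⟩ := hS.nonempty_of_mem hbS
      obtain ⟨y, hy⟩ := hS.nonempty_of_mem hb'
      rw [hS.mem_part_iff hp hb hb' hx hy, hS.mem_part_iff hp' hbp' hb' hx hy,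
        h x (mem_supp.2 ⟨b, hbS, hx⟩) y (mem_supp.2 ⟨b', hb', hy⟩)]
    · exact iff_of_false (fun h => hb' (Q.subset hp h)) fun h => hb' (Q'.subset hp' h)
  rwa [this]

/-- The level condition involves only the colors and the support, and fusing does not change the
support. This makes the pieces in `numLevel_mul` disjoint. -/
lemma IsBlockFamily.finpartition_eq_of_isLevelColoring (hS : IsBlockFamily S)
    {Q Q' : Finpartition S} {u : ℕ → ℕ} (h : IsLevelColoring (_root_.fuse Q) u)
    (h' : IsLevelColoring (_root_.fuse Q') u) : Q = Q' := by
  have key : ∀ x ∈ supp S, ∀ y ∈ supp S, x ≤ y →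
      (SameBlock (_root_.fuse Q) x y ↔ SameBlock (_root_.fuse Q') x y) := by
    intro x hx y hy hxy
    rcases hxy.lt_or_eq with hxy | rfl
    · rw [h x (by rwa [supp_fuse]) y (by rwa [supp_fuse]) hxy,
        h' x (by rwa [supp_fuse]) y (by rwa [supp_fuse]) hxy, supp_fuse, supp_fuse]
    · exact iff_of_true (sameBlock_self (by rwa [supp_fuse])) (sameBlock_self (by rwa [supp_fuse]))
  have key' : ∀ x ∈ supp S, ∀ y ∈ supp S,
      (SameBlock (_root_.fuse Q) x y ↔ SameBlock (_root_.fuse Q') x y) := by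
    intro x hx y hy
    rcases le_total x y with hxy | hxy
    · exact key x hx y hy hxy
    · exact ⟨fun hs => ((key y hy x hx hxy).1 hs.symm).symm,
        fun hs => ((key y hy x hx hxy).2 hs.symm).symm⟩
  ext1
  exact (hS.parts_subset_of_sameBlock_fuse key').antisymm
    (hS.parts_subset_of_sameBlock_fuse fun x hx y hy => (key' x hx y hy).symm)

end Fuse

/-- A crossing `x < y < z < t` would give `c x ≤ c y ≤ c z = c x`; then `x` and `y` have the same
color with nothing smaller between them, and their blocks coincide. In `numLevel_mul` this shows
that the quotient colors only ever produce noncrossing fusions. -/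
lemma IsLevelColoring.isNoncrossing {S : Finset (Finset ℕ)} (hS : IsBlockFamily S) {c : ℕ → ℕ}
    (hc : IsLevelColoring S c) : IsNoncrossing S := by
  rintro b hb b' hb' hne x hx z hz y hy t ht ⟨hxy, hyz, hzt⟩
  have hmem : ∀ {w d}, d ∈ S → w ∈ d → w ∈ supp S := fun hd hw => mem_supp.2 ⟨_, hd, hw⟩
  have h1 : c x ≤ c y := hc.le_of_sameBlock ⟨b, hb, hx, hz⟩ (hmem hb' hy)
    (by rw [Finset.mem_uIcc]; omega)
  have h2 : c y ≤ c z := hc.le_of_sameBlock ⟨b', hb', hy, ht⟩ (hmem hb hz)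
    (by rw [Finset.mem_uIcc]; omega)
  have h3 := hc.eq_of_sameBlock ⟨b, hb, hx, hz⟩
  obtain ⟨d, hd, hxd, hyd⟩ := (hc x (hmem hb hx) y (hmem hb' hy) hxy).2 ⟨by omega,
    fun w hw hxw hwy => hc.le_of_sameBlock ⟨b, hb, hx, hz⟩ hw (by rw [Finset.mem_uIcc]; omega)⟩
  exact hne ((hS.eq_of_mem hb hd hx hxd).trans (hS.eq_of_mem hb' hd hy hyd).symm)

/-- Division by `M` is weakly monotone, so the level relation of `c / M` is coarser than that of
`c`. Its classes are therefore unions of blocks. -/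
lemma exists_isLevelColoring_fuse_div {S : Finset (Finset ℕ)} {c : ℕ → ℕ}
    (hc : IsLevelColoring S c) (M : ℕ) :
    ∃ Q : Finpartition S, IsLevelColoring (fuse Q) fun x => c x / M := by
  classical
  let R : ℕ → ℕ → Prop := fun x y =>
    c x / M = c y / M ∧ ∀ z ∈ supp S, z ∈ Finset.uIcc x y → c x / M ≤ c z / M
  have hsymm : ∀ {x y}, R x y → R y x := fun ⟨h1, h2⟩ =>
    ⟨h1.symm, fun z hz hz' => h1 ▸ h2 z hz (by rwa [Finset.uIcc_comm])⟩
  have htrans : ∀ {x y z}, R x y → R y z → R x z := by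
    rintro x y z ⟨h1, h2⟩ ⟨h3, h4⟩
    refine ⟨h1.trans h3, fun w hw hw' => ?_⟩
    by_cases h : w ∈ Finset.uIcc x y
    · exact h2 w hw h
    · refine h1 ▸ h4 w hw ?_
      rw [Finset.mem_uIcc] at *
      omega
  have hblock : ∀ {b x y}, b ∈ S → x ∈ b → y ∈ b → R x y := fun hb hx hy =>
    ⟨by rw [hc.eq_of_sameBlock ⟨_, hb, hx, hy⟩],
      fun z hz hz' => Nat.div_le_div_right (hc.le_of_sameBlock ⟨_, hb, hx, hy⟩ hz hz')⟩
  -- `κ b` is the `R`-class of the points of `b`, so the kernel of `κ` is the relation induced by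
  -- `R` on the blocks.
  let κ : Finset ℕ → Finset ℕ := fun b => (supp S).filter fun z => ∃ x ∈ b, R x z
  have hκ : ∀ {b b' x y}, b ∈ S → b' ∈ S → x ∈ b → y ∈ b' → (κ b = κ b' ↔ R x y) := by
    intro b b' x y hb hb' hx hy
    constructor
    · intro h
      have : y ∈ κ b' := Finset.mem_filter.2 ⟨mem_supp.2 ⟨b', hb', hy⟩, y, hy, hblock hb' hy hy⟩
      rw [← h] at this
      obtain ⟨-, x', hx', h'⟩ := Finset.mem_filter.1 this
      exact htrans (hblock hb hx hx') h'
    · intro h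
      refine Finset.filter_congr fun z _ => ⟨?_, ?_⟩
      · rintro ⟨x', hx', h'⟩
        exact ⟨y, hy, htrans (hsymm h) (htrans (hblock hb hx hx') h')⟩
      · rintro ⟨y', hy', h'⟩
        exact ⟨x, hx, htrans h (htrans (hblock hb' hy hy') h')⟩
  refine ⟨Finpartition.ofSetSetoid (Setoid.ker κ) S, fun x hx y hy hxy => ?_⟩
  rw [supp_fuse] at hx hy ⊢
  obtain ⟨b, hb, hxb⟩ := mem_supp.1 hx
  obtain ⟨b', hb', hyb'⟩ := mem_supp.1 hy
  have hR : R x y ↔ (c x / M = c y / M ∧ ∀ z ∈ supp S, x < z → z < y → c x / M ≤ c z / M) := by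
    refine and_congr_right fun h => ⟨fun h' z hz hxz hzy => h' z hz ?_, fun h' z hz hz' => ?_⟩
    · rw [Finset.mem_uIcc]; omega
    · rw [Finset.mem_uIcc] at hz'
      by_cases h1 : z = x
      · rw [h1]
      by_cases h2 : z = y
      · rw [h2, h]
      exact h' z hz (by omega) (by omega)
  rw [← hR, ← hκ hb hb' hxb hyb', sameBlock_fuse]
  constructor
  · rintro ⟨p, hp, hxp, hyp⟩
    obtain ⟨d, hd, hxd⟩ := mem_supp.1 hxp
    obtain ⟨d', hd', hyd'⟩ := mem_supp.1 hyp
    obtain ⟨a, ha, rfl⟩ := Finset.mem_image.1 hp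
    obtain ⟨hdS, hd⟩ := Finset.mem_filter.1 hd
    obtain ⟨hdS', hd'⟩ := Finset.mem_filter.1 hd'
    have e1 : κ b = κ d := (hκ hb hdS hxb hxd).2 (hblock hb hxb hxb)
    have e2 : κ b' = κ d' := (hκ hb' hdS' hyb' hyd').2 (hblock hb' hyb' hyb')
    rw [e1, e2]
    exact hd.symm.trans hd'
  · intro h
    exact ⟨_, Finset.mem_image_of_mem _ hb,
      mem_supp.2 ⟨b, Finset.mem_filter.2 ⟨hb, rfl⟩, hxb⟩,
      mem_supp.2 ⟨b', Finset.mem_filter.2 ⟨hb', h⟩, hyb'⟩⟩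

lemma le_iff_of_div_eq {a b M : ℕ} (h : a / M = b / M) : a ≤ b ↔ a % M ≤ b % M := by
  rw [← Nat.div_add_mod a M, ← Nat.div_add_mod b M, h]
  simp

lemma eq_iff_of_div_eq {a b M : ℕ} (h : a / M = b / M) : a = b ↔ a % M = b % M := by
  rw [le_antisymm_iff, le_antisymm_iff, le_iff_of_div_eq h, le_iff_of_div_eq h.symm]

/-- Colors compare lexicographically by quotient and remainder. Between two points of one class no
quotient is smaller; a point with a larger quotient has a larger color, and a point with the same
quotient belongs to the same class, where only remainders count. Points in different classes already
fail the level condition for the quotients, hence also for `c`. -/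
lemma isLevelColoring_iff_mod {S : Finset (Finset ℕ)} (hS : IsBlockFamily S) {Q : Finpartition S}
    {c : ℕ → ℕ} {M : ℕ} (hQ : IsLevelColoring (fuse Q) fun x => c x / M) :
    IsLevelColoring S c ↔ ∀ p ∈ Q.parts, IsLevelColoring p fun x => c x % M := by
  have key : ∀ p ∈ Q.parts, ∀ x ∈ supp p, ∀ y ∈ supp p, x < y →
      ((SameBlock S x y ↔ c x = c y ∧ ∀ z ∈ supp S, x < z → z < y → c x ≤ c z) ↔
        (SameBlock p x y ↔
          c x % M = c y % M ∧ ∀ z ∈ supp p, x < z → z < y → c x % M ≤ c z % M)) := by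
    intro p hp x hx y hy hxy
    have hpS := supp_mono (Q.subset hp)
    have hsame : SameBlock (fuse Q) x y := (sameBlock_fuse Q).2 ⟨p, hp, hx, hy⟩
    have hdiv : ∀ z ∈ supp p, c x / M = c z / M := fun z hz =>
      hQ.eq_of_sameBlock ((sameBlock_fuse Q).2 ⟨p, hp, hx, hz⟩)
    rw [hS.sameBlock_iff_of_subset (Q.subset hp) hx, eq_iff_of_div_eq (hdiv y hy)]
    refine iff_congr Iff.rfl (and_congr_right fun _ => ⟨fun h z hz hxz hzy => ?_,
      fun h z hz hxz hzy => ?_⟩)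
    · exact (le_iff_of_div_eq (hdiv z hz)).1 (h z (hpS hz) hxz hzy)
    · have hle : ∀ w ∈ supp S, w ∈ Finset.uIcc x y → c x / M ≤ c w / M := fun w hw hw' =>
        hQ.le_of_sameBlock hsame (by rwa [supp_fuse]) hw'
      rcases (hle z hz (by rw [Finset.mem_uIcc]; omega)).lt_or_eq with hlt | heq
      · exact (Nat.lt_of_div_lt_div hlt).le
      · have hxz' : SameBlock (fuse Q) x z := by
          rw [hQ x (by rw [supp_fuse]; exact hpS hx) z (by rwa [supp_fuse]) hxz, supp_fuse]
          exact ⟨heq, fun w hw hxw hwz => hle w hw (by rw [Finset.mem_uIcc]; omega)⟩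
        obtain ⟨q, hq, hxq, hzq⟩ := (sameBlock_fuse Q).1 hxz'
        obtain rfl := hS.part_eq hp hq hx hxq
        exact (le_iff_of_div_eq heq).2 (h z hzq hxz hzy)
  constructor
  · exact fun h p hp x hx y hy hxy => (key p hp x hx y hy hxy).1
      (h x (supp_mono (Q.subset hp) hx) y (supp_mono (Q.subset hp) hy) hxy)
  · intro h x hx y hy hxy
    by_cases hxy' : SameBlock (fuse Q) x y
    · obtain ⟨p, hp, hxp, hyp⟩ := (sameBlock_fuse Q).1 hxy'
      exact (key p hp x hxp y hyp hxy).2 (h p hp x hxp y hyp hxy)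
    · refine iff_of_false (fun ⟨b, hb, hxb, hyb⟩ => hxy' ?_) fun ⟨h1, h2⟩ => hxy' ?_
      · obtain ⟨p, hp, hbp⟩ := Q.exists_mem hb
        exact (sameBlock_fuse Q).2 ⟨p, hp, mem_supp.2 ⟨b, hbp, hxb⟩, mem_supp.2 ⟨b, hbp, hyb⟩⟩
      · rw [hQ x (by rwa [supp_fuse]) y (by rwa [supp_fuse]) hxy, supp_fuse]
        exact ⟨congrArg (· / M) h1, fun z hz hxz hzy => Nat.div_le_div_right (h2 z hz hxz hzy)⟩

lemma card_coloringsWith_div_mod (U : Finset ℕ) (N : ℕ) {M : ℕ} (hM : 0 < M)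
    {P P' : (ℕ → ℕ) → Prop} (hP : ∀ c d, (∀ x ∈ U, c x = d x) → (P c ↔ P d))
    (hP' : ∀ c d, (∀ x ∈ U, c x = d x) → (P' c ↔ P' d)) :
    (coloringsWith U (N * M) fun c => P (fun x => c x / M) ∧ P' (fun x => c x % M)).card =
      (coloringsWith U N P).card * (coloringsWith U M P').card := by
  rw [← Finset.card_product]
  refine Finset.card_nbij' (fun c => (extendZero U fun x => c x / M, extendZero U fun x => c x % M))
    (fun p => extendZero U fun x => M * p.1 x + p.2 x) ?_ ?_ ?_ ?_
  · intro c hc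
    simp only [Finset.mem_coe, Finset.mem_product, mem_coloringsWith,
      extendZero_mem_colorings] at hc ⊢
    refine ⟨⟨fun x hx => ?_, ?_⟩, fun x _ => Nat.mod_lt _ hM, ?_⟩
    · exact Nat.div_lt_of_lt_mul (mul_comm N M ▸ (mem_colorings.1 hc.1).2 x hx)
    · exact (hP _ _ fun x hx => extendZero_apply hx).2 hc.2.1
    · exact (hP' _ _ fun x hx => extendZero_apply hx).2 hc.2.2
  · intro p hp
    simp only [Finset.mem_coe, Finset.mem_product, mem_coloringsWith,
      extendZero_mem_colorings] at hp ⊢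
    have h2 := (mem_colorings.1 hp.2.1).2
    refine ⟨fun x hx => ?_, (hP _ _ fun x hx => ?_).2 hp.1.2, (hP' _ _ fun x hx => ?_).2 hp.2.2⟩
    · have h1 := (mem_colorings.1 hp.1.1).2 x hx
      calc M * p.1 x + p.2 x < M * p.1 x + M := by have := h2 x hx; omega
        _ = (p.1 x + 1) * M := by ring
        _ ≤ N * M := Nat.mul_le_mul_right _ h1
    · rw [extendZero_apply hx, Nat.mul_add_div hM, Nat.div_eq_of_lt (h2 x hx), add_zero]
    · rw [extendZero_apply hx, Nat.mul_add_mod, Nat.mod_eq_of_lt (h2 x hx)]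
  · intro c hc
    simp only [Finset.mem_coe, mem_coloringsWith] at hc
    have : ∀ x ∈ U, M * (extendZero U fun x => c x / M) x + (extendZero U fun x => c x % M) x
        = c x := fun x hx => by
      rw [extendZero_apply hx, extendZero_apply hx, Nat.div_add_mod]
    refine colorings_ext (N := N * M) (extendZero_mem_colorings.2 fun x hx => ?_) hc.1
      fun x hx => ?_
    · rw [this x hx]; exact (mem_colorings.1 hc.1).2 x hx
    · rw [extendZero_apply hx]; exact this x hx
  · intro p hp
    simp only [Finset.mem_coe, Finset.mem_product, mem_coloringsWith] at hp
    have h2 := (mem_colorings.1 hp.2.1).2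
    have e1 : ∀ x ∈ U, (extendZero U fun x => M * p.1 x + p.2 x) x / M = p.1 x := fun x hx => by
      rw [extendZero_apply hx, Nat.mul_add_div hM, Nat.div_eq_of_lt (h2 x hx), add_zero]
    have e2 : ∀ x ∈ U, (extendZero U fun x => M * p.1 x + p.2 x) x % M = p.2 x := fun x hx => by
      rw [extendZero_apply hx, Nat.mul_add_mod, Nat.mod_eq_of_lt (h2 x hx)]
    refine Prod.ext ?_ ?_
    · refine colorings_ext (N := N) (extendZero_mem_colorings.2 fun x hx => ?_) hp.1.1
        fun x hx => ?_
      · rw [e1 x hx]; exact (mem_colorings.1 hp.1.1).2 x hx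
      · rw [extendZero_apply hx, e1 x hx]
    · refine colorings_ext (N := M) (extendZero_mem_colorings.2 fun x hx => ?_) hp.2.1
        fun x hx => ?_
      · rw [e2 x hx]; exact h2 x hx
      · rw [extendZero_apply hx, e2 x hx]

open Classical in
/-- Level colorings with `N * M` colors, according to the level partition of the quotients of the
colors by `M`. -/
theorem numLevel_mul {S : Finset (Finset ℕ)} (hS : IsBlockFamily S) (N : ℕ) {M : ℕ}
    (hM : 0 < M) :
    numLevel S (N * M) =
      ∑ Q ∈ (Finset.univ : Finset (Finpartition S)).filter fun Q => IsNoncrossing (fuse Q),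
        numLevel (fuse Q) N * ∏ p ∈ Q.parts, numLevel p M := by
  have hunion : levelColorings S (N * M) =
      ((Finset.univ : Finset (Finpartition S)).filter fun Q => IsNoncrossing (fuse Q)).biUnion
        fun Q => coloringsWith (supp S) (N * M) fun c => IsLevelColoring (fuse Q) (fun x => c x / M)
          ∧ ∀ p ∈ Q.parts, IsLevelColoring p fun x => c x % M := by
    ext c
    simp only [mem_levelColorings, Finset.mem_biUnion, Finset.mem_filter, Finset.mem_univ,
      true_and, mem_coloringsWith]
    constructor
    · rintro ⟨h1, h2⟩
      obtain ⟨Q, hQ⟩ := exists_isLevelColoring_fuse_div h2 M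
      exact ⟨Q, hQ.isNoncrossing (hS.fuse Q), h1, hQ, (isLevelColoring_iff_mod hS hQ).1 h2⟩
    · rintro ⟨Q, -, h1, hQ, h2⟩
      exact ⟨h1, (isLevelColoring_iff_mod hS hQ).2 h2⟩
  rw [numLevel, hunion, Finset.card_biUnion]
  · refine Finset.sum_congr rfl fun Q _ => ?_
    have hbi : Q.parts.biUnion supp = supp S := by
      rw [← supp_fuse Q]
      ext x
      simp [mem_supp, fuse]
    rw [card_coloringsWith_div_mod (supp S) N hM (P := IsLevelColoring (fuse Q))
      (P' := fun v => ∀ p ∈ Q.parts, IsLevelColoring p v)]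
    · rw [numLevel, levelColorings, supp_fuse]
      congr 1
      rw [← hbi]
      refine card_coloringsWith_biUnion Q.parts supp ?_ M (fun p => IsLevelColoring p)
        fun p _ c d h => isLevelColoring_congr h
      intro p hp q hq hne
      exact Finset.disjoint_left.2 fun x hx hx' => hne (hS.part_eq hp hq hx hx')
    · exact fun c d h => isLevelColoring_congr fun x hx => h x (by rwa [supp_fuse] at hx)
    · exact fun c d h => forall₂_congr fun p hp =>
        isLevelColoring_congr fun x hx => h x (supp_mono (Q.subset hp) hx)
  · intro Q _ Q' _ hne
    refine Finset.disjoint_left.2 fun c hc hc' => hne ?_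
    rw [mem_coloringsWith] at hc hc'
    exact hS.finpartition_eq_of_isLevelColoring hc.2.1 hc'.2.1

/-! ## Powers and logarithms of unitriangular matrices -/

namespace LowerTri

variable {R : Type*} [CommRing R]

lemma ext_entry {A B : LowerTri R} (h : ∀ k l, l ≤ k → A.entry k l = B.entry k l) : A = B :=
  IncidenceAlgebra.ext fun a b hab => h (OrderDual.ofDual a) (OrderDual.ofDual b) hab

lemma entry_add (A B : LowerTri R) (k l : ℕ) :
    (A + B).entry k l = A.entry k l + B.entry k l := rfl

lemma entry_sub (A B : LowerTri R) (k l : ℕ) :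
    (A - B).entry k l = A.entry k l - B.entry k l := rfl

lemma entry_smul {S : Type*} [Monoid S] [DistribMulAction S R] (a : S) (A : LowerTri R)
    (k l : ℕ) : (a • A).entry k l = a • A.entry k l := rfl

lemma entry_smul_pow (a : R) (A : LowerTri R) :
    ∀ n k l : ℕ, ((a • A) ^ n).entry k l = a ^ n * (A ^ n).entry k l
  | 0, k, l => by simp
  | n + 1, k, l => by
    rw [pow_succ, pow_succ A, entry_mul, entry_mul, Finset.mul_sum]
    refine Finset.sum_congr rfl fun j _ => ?_
    rw [entry_smul_pow a A n, entry_smul, smul_eq_mul]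
    ring

lemma entry_one (k l : ℕ) : (1 : LowerTri R).entry k l = if k = l then 1 else 0 := by
  simp [entry, IncidenceAlgebra.one_apply]

lemma entry_sum {ι : Type*} (s : Finset ι) (A : ι → LowerTri R) (k l : ℕ) :
    (∑ i ∈ s, A i).entry k l = ∑ i ∈ s, (A i).entry k l := by
  classical
  induction s using Finset.induction_on with
  | empty => rfl
  | insert a s ha ih => rw [Finset.sum_insert ha, Finset.sum_insert ha, entry_add, ih]

/-- The extra terms vanish by triangularity. A summation range independent of `l` and of the row
makes it possible to interchange sums. -/
lemma entry_mul_range (A B : LowerTri R) {k l n : ℕ} (hn : k < n) :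
    (A * B).entry k l = ∑ j ∈ Finset.range n, A.entry k j * B.entry j l := by
  rw [entry_mul]
  refine Finset.sum_subset (fun j hj => ?_) fun j _ hj => ?_
  · rw [Finset.mem_Icc] at hj
    rw [Finset.mem_range]
    omega
  · rw [Finset.mem_Icc] at hj
    by_cases hjl : j < l
    · rw [entry_eq_zero B hjl, mul_zero]
    · rw [entry_eq_zero A (by omega), zero_mul]

lemma mulVec_eq_range (A : LowerTri R) (v : ℕ → R) {k n : ℕ} (hn : k < n) :
    A.mulVec v k = ∑ l ∈ Finset.range n, A.entry k l * v l := by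
  rw [mulVec]
  refine Finset.sum_subset (fun j hj => ?_) fun j _ hj => ?_
  · rw [Finset.mem_range] at *; omega
  · rw [entry_eq_zero A (by rw [Finset.mem_range] at hj; omega), zero_mul]

lemma mulVec_mulVec (A B : LowerTri R) (v : ℕ → R) : A.mulVec (B.mulVec v) = (A * B).mulVec v := by
  funext k
  have h1 : ∀ l ∈ Finset.range (k + 1),
      B.mulVec v l = ∑ j ∈ Finset.range (k + 1), B.entry l j * v j := fun l hl =>
    mulVec_eq_range B v (Finset.mem_range.1 hl)
  calc A.mulVec (B.mulVec v) k
      = ∑ l ∈ Finset.range (k + 1), ∑ j ∈ Finset.range (k + 1),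
          A.entry k l * B.entry l j * v j := by
        refine Finset.sum_congr rfl fun l hl => ?_
        rw [h1 l hl, Finset.mul_sum]
        exact Finset.sum_congr rfl fun j _ => by ring
    _ = (A * B).mulVec v k := by
        rw [Finset.sum_comm, mulVec]
        refine Finset.sum_congr rfl fun j _ => ?_
        rw [entry_mul_range A B (Nat.lt_succ_self k), Finset.sum_mul]

lemma mulVec_single_zero (A : LowerTri R) (k : ℕ) : A.mulVec (Pi.single 0 1) k = A.entry k 0 := by
  rw [mulVec, Finset.sum_eq_single 0]
  · simp
  · intro l _ hl
    simp [hl]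
  · simp

section Map

variable {S : Type*} [CommRing S] (f : R →+* S) {A : LowerTri R} {B : LowerTri S}

lemma entry_pow_map (h : ∀ k l, B.entry k l = f (A.entry k l)) :
    ∀ (n k l : ℕ), (B ^ n).entry k l = f ((A ^ n).entry k l)
  | 0, k, l => by
    rw [pow_zero, pow_zero, entry_one, entry_one]
    split_ifs <;> simp
  | n + 1, k, l => by
    rw [pow_succ, pow_succ, entry_mul, entry_mul, map_sum]
    refine Finset.sum_congr rfl fun j _ => ?_
    rw [entry_pow_map h n, h, map_mul]

variable [Algebra ℚ R] [Algebra ℚ S]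

/-- Used with `f = C`: the logarithm in the theorem is taken over `K[X]`, but its entries come from
the logarithm over `K`. -/
lemma entry_log_map (h : ∀ k l, B.entry k l = f (A.entry k l))
    (hA : ∀ k, (A - 1).entry k k = 0) (k l : ℕ) : B.log.entry k l = f (A.log.entry k l) := by
  have h1 : ∀ k l, (B - 1).entry k l = f ((A - 1).entry k l) := fun k l => by
    rw [entry_sub, entry_sub, map_sub, h, entry_one, entry_one]
    split_ifs <;> simp
  by_cases hkl : l ≤ k
  · rw [entry_log hA hkl, entry_log (fun k => by rw [h1, hA, map_zero]) hkl, map_sum]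
    refine Finset.sum_congr rfl fun n _ => ?_
    rw [entry_pow_map f h1, map_rat_smul f]
  · rw [entry_eq_zero _ (by omega), entry_eq_zero _ (by omega), map_zero]

end Map

variable [Algebra ℚ R] {A : LowerTri R}

/-- On the rows below `n` the logarithm is one and the same polynomial in `A`, whatever the column.
-/
lemma entry_log_eq_sum (hA : ∀ k, (A - 1).entry k k = 0) {k n : ℕ} (hn : k < n) (l : ℕ) :
    A.log.entry k l = (∑ m ∈ Finset.range n,
      ((-1) ^ m / ((m : ℚ) + 1)) • (A - 1) ^ (m + 1)).entry k l := by
  by_cases hkl : l ≤ k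
  · rw [entry_log hA hkl, entry_sum]
    refine Finset.sum_subset (fun j hj => ?_) fun j _ hj => ?_
    · rw [Finset.mem_range] at *; omega
    · rw [Finset.mem_range] at hj
      rw [entry_pow_eq_zero hA (j + 1) (by omega), smul_zero]
  · rw [entry_eq_zero _ (by omega), entry_eq_zero _ (by omega)]

lemma entry_log_self (hA : ∀ k, (A - 1).entry k k = 0) (k : ℕ) : A.log.entry k k = 0 := by
  rw [entry_log hA le_rfl]
  exact Finset.sum_eq_zero fun n _ => by
    rw [entry_pow_eq_zero hA (n + 1) (by omega), smul_zero]

/-- Row `k` of either product only involves rows up to `k`, and on these the logarithm is a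
polynomial in `A`, which commutes with `A`. -/
lemma mul_log_comm (hA : ∀ k, (A - 1).entry k k = 0) : A * A.log = A.log * A := by
  refine ext_entry fun k l _ => ?_
  set B : LowerTri R := ∑ m ∈ Finset.range (k + 1),
      ((-1) ^ m / ((m : ℚ) + 1)) • (A - 1) ^ (m + 1) with hB
  have hL : ∀ j ∈ Finset.range (k + 1), ∀ i, A.log.entry j i = B.entry j i := fun j hj i =>
    entry_log_eq_sum hA (Finset.mem_range.1 hj) i
  have hcomm : Commute A B := by
    refine Commute.sum_right _ _ _ fun m _ => Commute.smul_right (Commute.pow_right ?_ _) _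
    exact (Commute.refl A).sub_right (Commute.one_right A)
  calc (A * A.log).entry k l = (A * B).entry k l := by
        rw [entry_mul_range _ _ (Nat.lt_succ_self k), entry_mul_range _ _ (Nat.lt_succ_self k)]
        exact Finset.sum_congr rfl fun j hj => by rw [hL j hj]
    _ = (B * A).entry k l := by rw [hcomm.eq]
    _ = (A.log * A).entry k l := by
        rw [entry_mul_range _ _ (Nat.lt_succ_self k), entry_mul_range _ _ (Nat.lt_succ_self k)]
        exact Finset.sum_congr rfl fun j hj => by rw [hL k (by simp)]

end LowerTri

/-! ## The flow of a unitriangular matrix -/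

section Flow

open Polynomial

variable {K : Type*} [Field K]

lemma descPochhammer_eval_neg_one (n : ℕ) :
    (descPochhammer K n).eval (-1) = (-1) ^ n * (n.factorial : K) := by
  induction n with
  | zero => simp
  | succ n ih =>
    rw [descPochhammer_succ_eval, ih, Nat.factorial_succ]
    push_cast
    ring

/-- The falling factorial is `X` times its shifted predecessor, so the derivative at `0` is the
predecessor's value at `-1`. Divided by `(n + 1)!`, it becomes the coefficient `(-1)ⁿ / (n + 1)` of
the logarithm. -/
lemma derivative_descPochhammer_succ_eval_zero (n : ℕ) :
    (derivative (descPochhammer K (n + 1))).eval 0 = (-1) ^ n * (n.factorial : K) := by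
  rw [descPochhammer_succ_left, derivative_mul]
  simp [descPochhammer_eval_neg_one]

variable [CharZero K]

lemma Polynomial.eq_of_eval_natCast_eq {p q : K[X]} (h : ∀ n : ℕ, p.eval (n : K) = q.eval (n : K)) :
    p = q := by
  refine Polynomial.eq_of_infinite_eval_eq p q (Set.Infinite.mono ?_
    (Set.infinite_range_of_injective (Nat.cast_injective (R := K))))
  rintro _ ⟨n, rfl⟩
  exact h n

/-- The polynomial entries of the powers of a unitriangular matrix, in the binomial basis. -/
def powEntry (A : LowerTri K) (k : ℕ) : K[X] :=
  ∑ n ∈ Finset.range (k + 1),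
    C (((A - 1) ^ n).entry k 0 / (n.factorial : K)) * descPochhammer K n

/-- This is the binomial expansion of `(1 + (A - 1)) ^ j`, truncated at `n = k` because higher
powers of `A - 1` vanish in row `k`. -/
lemma eval_powEntry {A : LowerTri K} (hA : ∀ k, (A - 1).entry k k = 0) (k j : ℕ) :
    (powEntry A k).eval (j : K) = (A ^ j).entry k 0 := by
  have h1 : A ^ j = ∑ n ∈ Finset.range (j + 1), (j.choose n : K) • (A - 1) ^ n := by
    conv_lhs => rw [← sub_add_cancel A 1, (Commute.one_right (A - 1)).add_pow]
    refine Finset.sum_congr rfl fun n _ => ?_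
    rw [one_pow, mul_one, Nat.cast_smul_eq_nsmul, nsmul_eq_mul, Nat.cast_comm]
  have h2 : ∀ n : ℕ, ((A - 1) ^ n).entry k 0 / (n.factorial : K) *
      (descPochhammer K n).eval (j : K) = (j.choose n : K) * ((A - 1) ^ n).entry k 0 := fun n => by
    rw [descPochhammer_eval_eq_descFactorial, Nat.descFactorial_eq_factorial_mul_choose]
    have := (Nat.cast_ne_zero (R := K)).2 n.factorial_ne_zero
    push_cast
    field_simp
  have h3 : (powEntry A k).eval (j : K) =
      ∑ n ∈ Finset.range (k + 1), (j.choose n : K) * ((A - 1) ^ n).entry k 0 := by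
    rw [powEntry, eval_finsetSum]
    refine Finset.sum_congr rfl fun n _ => ?_
    rw [eval_mul, eval_C, h2]
  have h4 : (A ^ j).entry k 0 =
      ∑ n ∈ Finset.range (j + 1), (j.choose n : K) * ((A - 1) ^ n).entry k 0 := by
    rw [h1, LowerTri.entry_sum]
    rfl
  rw [h3, h4]
  -- Both sums can be extended to a common bound: beyond `k` the matrix power vanishes, beyond `j`
  -- the binomial coefficient does.
  have h5 : ∀ m, k ≤ m → j ≤ m → ∀ i, i = k ∨ i = j →
      ∑ n ∈ Finset.range (i + 1), (j.choose n : K) * ((A - 1) ^ n).entry k 0 =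
        ∑ n ∈ Finset.range (m + 1), (j.choose n : K) * ((A - 1) ^ n).entry k 0 := by
    intro m hk hj i hi
    refine Finset.sum_subset (fun n hn => ?_) fun n _ hn => ?_
    · rw [Finset.mem_range] at *; omega
    · rw [Finset.mem_range] at hn
      rcases hi with rfl | rfl
      · rw [LowerTri.entry_pow_eq_zero hA n (by omega), mul_zero]
      · rw [Nat.choose_eq_zero_of_lt (by omega), Nat.cast_zero, zero_mul]
  rw [h5 (max k j) (by omega) (by omega) k (Or.inl rfl),
    h5 (max k j) (by omega) (by omega) j (Or.inr rfl)]

lemma eval_zero_derivative_powEntry {A : LowerTri K} (hA : ∀ k, (A - 1).entry k k = 0) (k : ℕ) :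
    (derivative (powEntry A k)).eval 0 = A.log.entry k 0 := by
  -- The constant term of `powEntry` disappears under differentiation, and the last term of the
  -- logarithm contains `(A - 1) ^ (k + 1)`, which vanishes at `(k, 0)`. The remaining `k` terms
  -- match.
  rw [LowerTri.entry_log_eq_sum hA (Nat.lt_succ_self k), LowerTri.entry_sum, powEntry,
    derivative_sum, eval_finsetSum, Finset.sum_range_succ', Finset.sum_range_succ,
    LowerTri.entry_smul, LowerTri.entry_pow_eq_zero hA (k + 1) (by omega)]
  simp only [descPochhammer_zero, mul_one, derivative_C, eval_zero, smul_zero]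
  congr 1
  refine Finset.sum_congr rfl fun n _ => ?_
  have h1 := (Nat.cast_ne_zero (R := K)).2 n.factorial_ne_zero
  have h2 : (n : K) + 1 ≠ 0 := by exact_mod_cast n.succ_ne_zero
  rw [derivative_C_mul, eval_mul, eval_C, derivative_descPochhammer_succ_eval_zero,
    LowerTri.entry_smul, Rat.smul_def, Nat.factorial_succ]
  push_cast
  field_simp

/-- At natural numbers this is `A ^ (j + 1) = A * A ^ j`, and a polynomial over a field of
characteristic zero is determined by these values. -/
lemma powEntry_comp_X_add_one {A : LowerTri K} (hA : ∀ k, (A - 1).entry k k = 0) (k : ℕ) :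
    (powEntry A k).comp (X + 1) =
      ∑ l ∈ Finset.range (k + 1), C (A.entry k l) * powEntry A l := by
  refine Polynomial.eq_of_eval_natCast_eq fun j => ?_
  have h : ((j : K) + 1) = ((j + 1 : ℕ) : K) := by push_cast; rfl
  rw [eval_comp, eval_add, eval_X, eval_one, h, eval_powEntry hA, pow_succ',
    LowerTri.entry_mul_range _ _ (Nat.lt_succ_self k), eval_finsetSum]
  refine Finset.sum_congr rfl fun l _ => ?_
  rw [eval_mul, eval_C, eval_powEntry hA]

/-- Write `P` for the vector of these polynomials. Differentiating `P(X + 1) = A P(X)` gives `P'(j)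
= A ^ j P'(0)`, with `P'(0)` the first column of `log A`. Since `A` and its logarithm commute,
`P'(j) = (log A) P(j)` for every natural number `j`. -/
lemma derivative_powEntry {A : LowerTri K} (hA : ∀ k, (A - 1).entry k k = 0) (k : ℕ) :
    derivative (powEntry A k) =
      ∑ l ∈ Finset.range (k + 1), C (A.log.entry k l) * powEntry A l := by
  refine Polynomial.eq_of_eval_natCast_eq fun j => ?_
  have hstep : ∀ (x : K), (fun k => (derivative (powEntry A k)).eval (x + 1)) =
      A.mulVec fun k => (derivative (powEntry A k)).eval x := by
    intro x
    funext k
    have := congrArg (fun p => (derivative p).eval x) (powEntry_comp_X_add_one hA k)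
    simpa [derivative_comp, eval_finsetSum, LowerTri.mulVec] using this
  have hpow : (fun k => (powEntry A k).eval (j : K)) = (A ^ j).mulVec (Pi.single 0 1) := by
    funext k
    rw [LowerTri.mulVec_single_zero, eval_powEntry hA]
  have hmain : (fun k => (derivative (powEntry A k)).eval (j : K)) =
      A.log.mulVec ((A ^ j).mulVec (Pi.single 0 1)) := by
    clear hpow
    induction j with
    | zero =>
      funext k
      rw [pow_zero, LowerTri.mulVec_mulVec, mul_one, LowerTri.mulVec_single_zero, Nat.cast_zero,
        eval_zero_derivative_powEntry hA]
    | succ j ih =>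
      rw [Nat.cast_succ, hstep, ih, LowerTri.mulVec_mulVec, LowerTri.mul_log_comm hA,
        ← LowerTri.mulVec_mulVec, LowerTri.mulVec_mulVec A, pow_succ']
  rw [← hpow] at hmain
  have := congrFun hmain k
  simpa [LowerTri.mulVec, eval_finsetSum] using this

/-- The entries of `e^{X L}` in the first column. -/
lemma entry_exp_X_smul {L : LowerTri K} {L' : LowerTri K[X]}
    (h : ∀ k l, L'.entry k l = C (L.entry k l)) (hL : ∀ k, L.entry k k = 0) {k n : ℕ}
    (hn : k < n) :
    (LowerTri.exp ((X : K[X]) • L')).entry k 0 =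
      ∑ m ∈ Finset.range n, C ((L ^ m).entry k 0 / (m.factorial : K)) * X ^ m := by
  have h0 : ∀ k, ((X : K[X]) • L').entry k k = 0 := fun k => by
    rw [LowerTri.entry_smul, h, hL, map_zero, smul_zero]
  have hpow : ∀ m, ((((X : K[X]) • L') ^ m).entry k 0) = X ^ m * C ((L ^ m).entry k 0) := by
    intro m
    rw [LowerTri.entry_smul_pow, LowerTri.entry_pow_map C h]
  rw [LowerTri.entry_exp h0 (Nat.zero_le k)]
  have : ∀ m, (1 / (m.factorial : ℚ)) • (((X : K[X]) • L') ^ m).entry k 0 =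
      C ((L ^ m).entry k 0 / (m.factorial : K)) * X ^ m := fun m => by
    rw [hpow, Algebra.smul_def, Polynomial.algebraMap_apply, eq_ratCast, Rat.cast_div,
      Rat.cast_one, Rat.cast_natCast, one_div, div_eq_mul_inv, C_mul]
    ring
  simp only [this]
  refine Finset.sum_subset (fun j hj => ?_) fun j _ hj => ?_
  · rw [Finset.mem_range] at *; omega
  · rw [Finset.mem_range] at hj
    rw [LowerTri.entry_pow_eq_zero hL j (by omega), zero_div, C_0, zero_mul]

/-- Both families solve the same linear differential system with the same values at `0`. The
logarithm is strictly lower triangular, so the derivative of the `k`-th member involves only earlier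
members, and strong induction on `k` gives uniqueness. -/
theorem powEntry_eq_entry_exp {A : LowerTri K} {A' : LowerTri K[X]}
    (h : ∀ k l, A'.entry k l = C (A.entry k l)) (hA : ∀ k, (A - 1).entry k k = 0) (k : ℕ) :
    powEntry A k = (LowerTri.exp ((X : K[X]) • A'.log)).entry k 0 := by
  have hlog := LowerTri.entry_log_map C h hA
  have hL := LowerTri.entry_log_self hA
  set q : ℕ → K[X] := fun k => (LowerTri.exp ((X : K[X]) • A'.log)).entry k 0 with hq
  have hqs : ∀ {k n : ℕ}, k < n → q k =
      ∑ m ∈ Finset.range n, C ((A.log ^ m).entry k 0 / (m.factorial : K)) * X ^ m :=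
    fun hn => entry_exp_X_smul hlog hL hn
  clear_value q
  have hq0 : ∀ k, (q k).eval 0 = (powEntry A k).eval 0 := by
    intro k
    have := eval_powEntry hA k 0
    rw [Nat.cast_zero] at this
    rw [this, hqs (Nat.lt_succ_self k), eval_finsetSum,
      Finset.sum_range_succ']
    simp
  have hderiv : ∀ k, derivative (q k) =
      ∑ l ∈ Finset.range (k + 1), C (A.log.entry k l) * q l := by
    intro k
    have h1 : ∀ l ∈ Finset.range (k + 1), C (A.log.entry k l) * q l =
        ∑ m ∈ Finset.range (k + 1),
          C (A.log.entry k l * (A.log ^ m).entry l 0 / (m.factorial : K)) * X ^ m := by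
      intro l hl
      rw [hqs (Finset.mem_range.1 hl), Finset.mul_sum]
      refine Finset.sum_congr rfl fun m _ => ?_
      rw [← mul_assoc, ← C_mul, mul_div_assoc]
    -- Expanding `q k` with `k + 2` terms leaves `k + 1` after differentiation, as many as on the
    -- other side.
    rw [Finset.sum_congr rfl h1, Finset.sum_comm,
      hqs (show k < k + 2 by omega), derivative_sum, Finset.sum_range_succ']
    simp only [pow_zero, mul_one, derivative_C, add_zero]
    refine Finset.sum_congr rfl fun m _ => ?_
    rw [← Finset.sum_mul, ← map_sum, ← Finset.sum_div,
      ← LowerTri.entry_mul_range _ _ (Nat.lt_succ_self k), ← pow_succ', derivative_C_mul,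
      derivative_X_pow, ← mul_assoc, ← C_mul, Nat.factorial_succ, Nat.add_sub_cancel]
    have h1 := (Nat.cast_ne_zero (R := K)).2 m.factorial_ne_zero
    have h2 : (m : K) + 1 ≠ 0 := by exact_mod_cast m.succ_ne_zero
    congr 2
    push_cast
    field_simp
  suffices powEntry A k = q k by rw [this, hq]
  induction k using Nat.strong_induction_on with
  | _ k ih =>
    have hd : derivative (powEntry A k - q k) = 0 := by
      rw [derivative_sub, derivative_powEntry hA, hderiv, ← Finset.sum_sub_distrib]
      refine Finset.sum_eq_zero fun l hl => ?_
      rw [Finset.mem_range] at hl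
      rcases (Nat.lt_succ_iff.1 hl).lt_or_eq with hl | rfl
      · rw [ih l hl, sub_self]
      · rw [hL, map_zero, zero_mul, zero_mul, sub_self]
    have hc := Polynomial.eq_C_of_derivative_eq_zero hd
    rw [coeff_zero_eq_eval_zero, eval_sub, hq0, sub_self, C_0] at hc
    exact sub_eq_zero.1 hc

end Flow

/-! ## The Riordan array -/

lemma entry_riordanM (R : Type*) [CommRing R] (k l : ℕ) :
    (riordanM R).entry k l = if l ≤ k then (((l + 1).choose (k - l) : ℕ) : R) else 0 := by
  split_ifs with h
  · rw [riordanM, LowerTri.entry_of _ h, Nat.add_sub_add_right]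
  · exact LowerTri.entry_eq_zero _ (by omega)

lemma mk_entry_riordanM (R : Type*) [CommRing R] (l : ℕ) :
    PowerSeries.mk (fun k => (riordanM R).entry k l) =
      (1 + PowerSeries.X) * (PowerSeries.X * (1 + PowerSeries.X)) ^ l := by
  -- Since columns are numbered from `0`, column `l` has generating series `X ^ l * (1 + X) ^ (l +
  -- 1)`.
  have h : (1 + PowerSeries.X : PowerSeries R) * (PowerSeries.X * (1 + PowerSeries.X)) ^ l =
      PowerSeries.X ^ l * (((1 + Polynomial.X) ^ (l + 1) : Polynomial R) : PowerSeries R) := by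
    push_cast
    rw [mul_pow, pow_succ]
    ring
  rw [h]
  ext k
  rw [PowerSeries.coeff_mk, PowerSeries.coeff_X_pow_mul', entry_riordanM]
  split_ifs with hk
  · rw [Polynomial.coeff_coe, Polynomial.coeff_one_add_X_pow]
  · rfl

/-! ## Nesting-free partitions -/

/-- The partition of `U` into singletons. -/
def singletons (U : Finset ℕ) : Finset (Finset ℕ) := U.image fun x => {x}

lemma supp_singletons (U : Finset ℕ) : supp (singletons U) = U := by
  ext x
  simp [mem_supp, singletons]

lemma sameBlock_singletons {U : Finset ℕ} {x y : ℕ} :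
    SameBlock (singletons U) x y ↔ x ∈ U ∧ x = y := by
  simp only [SameBlock, singletons, Finset.mem_image, exists_exists_and_eq_and,
    Finset.mem_singleton]
  constructor
  · rintro ⟨a, ha, rfl, rfl⟩
    exact ⟨ha, rfl⟩
  · rintro ⟨ha, rfl⟩
    exact ⟨x, ha, rfl, rfl⟩

lemma standardize_singletons (U : Finset ℕ) :
    standardize (singletons U) = singletons (Finset.Icc 1 U.card) := by
  rw [← image_rankIn, standardize, supp_singletons, singletons, singletons, Finset.image_image,
    Finset.image_image]
  exact Finset.image_congr fun x _ => Finset.image_singleton _ _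

lemma numLevel_singletons (U : Finset ℕ) (N : ℕ) :
    numLevel (singletons U) N = numLevel (singletons (Finset.range U.card)) N := by
  rw [← numLevel_standardize, standardize_singletons, ← numLevel_standardize (singletons
    (Finset.range _)), standardize_singletons, Finset.card_range]

lemma isLevelColoring_singletons {U : Finset ℕ} {c : ℕ → ℕ} :
    IsLevelColoring (singletons U) c ↔
      ∀ x ∈ U, ∀ y ∈ U, x < y → c x = c y → ∃ z ∈ U, x < z ∧ z < y ∧ c z < c x := by
  simp only [IsLevelColoring, supp_singletons, sameBlock_singletons]
  refine forall₂_congr fun x hx => forall₂_congr fun y hy => forall_congr' fun hxy => ?_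
  constructor
  · intro h hc
    by_contra! h'
    exact hxy.ne (h.2 ⟨hc, h'⟩).2
  · intro h
    refine iff_of_false (fun h' => hxy.ne h'.2) fun ⟨h1, h2⟩ => ?_
    obtain ⟨z, hz, hxz, hzy, hlt⟩ := h h1
    exact absurd (h2 z hz hxz hzy) (by omega)

/-- Let `d` have a point `x₀` to the left of all of `d'`. If some `x` in `d` lay beyond some `y` in
`d'`, noncrossing would forbid points of `d'` to the right of `d`, so `d'` would be nested in `d`.
Comparing minima tells which of the two blocks plays the role of `d`. -/
lemma NCPartition.NestingFree.lt_or_lt {π : NCPartition} (hπ : π.NestingFree) {b b' : Finset ℕ}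
    (hb : b ∈ π.blocks) (hb' : b' ∈ π.blocks) (hne : b ≠ b') :
    (∀ x ∈ b, ∀ y ∈ b', x < y) ∨ ∀ x ∈ b, ∀ y ∈ b', y < x := by
  have hS : IsBlockFamily π.blocks := π.2.2.1
  have hmin : ∀ {d d'}, d ∈ π.blocks → d' ∈ π.blocks → NCPartition.NestLE d d' → d = d' := by
    intro d d' hd hd' h
    have : d' ∈ π.base := by rwa [hπ]
    classical
    rw [NCPartition.base, Finset.mem_filter] at this
    exact this.2 d hd h
  have key : ∀ {d d'}, d ∈ π.blocks → d' ∈ π.blocks → d ≠ d' →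
      (∃ x ∈ d, ∀ y ∈ d', x < y) → ∀ x ∈ d, ∀ y ∈ d', x < y := by
    rintro d d' hd hd' hne ⟨x₀, hx₀, hlt⟩ x hx y hy
    by_contra! hyx
    have hxy : x ≠ y := fun h => hne (hS.eq_of_mem hd hd' hx (h ▸ hy))
    refine hne (hmin hd hd' fun t ht => ⟨⟨x₀, hx₀, (hlt t ht).le⟩, ?_⟩)
    by_contra! htd
    exact π.2.2.2.2 d hd d' hd' hne x₀ hx₀ x hx y hy t ht ⟨hlt y hy, by omega, htd x hx⟩
  have hn := hS.nonempty_of_mem hb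
  have hn' := hS.nonempty_of_mem hb'
  have hmm : b.min' hn ≠ b'.min' hn' := fun h =>
    hne (hS.eq_of_mem hb hb' (b.min'_mem hn) (h ▸ b'.min'_mem hn'))
  rcases lt_or_gt_of_ne hmm with h | h
  · exact Or.inl (key hb hb' hne ⟨_, b.min'_mem hn, fun y hy => h.trans_le (b'.min'_le y hy)⟩)
  · refine Or.inr fun x hx y hy => key hb' hb hne.symm
      ⟨_, b'.min'_mem hn', fun y hy => h.trans_le (b.min'_le y hy)⟩ y hy x hx

/-- The number of blocks of `S` which lie entirely to the left of `x`. -/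
def numBlocksLeft (S : Finset (Finset ℕ)) (x : ℕ) : ℕ :=
  (S.filter fun b => ∀ w ∈ b, w < x).card

lemma numBlocksLeft_mono (S : Finset (Finset ℕ)) : Monotone (numBlocksLeft S) := fun _ _ hxy =>
  Finset.card_le_card (Finset.monotone_filter_right _ fun _ _ h w hw => (h w hw).trans_le hxy)

namespace NCPartition.NestingFree

variable {π : NCPartition} (hπ : π.NestingFree)

include hπ

/-- The blocks are lined up from left to right, so `numBlocksLeft` is the index of the block of a
point: constant on blocks, different on different blocks. -/
lemma numBlocksLeft_eq_iff {x y : ℕ} (hx : x ∈ supp π.blocks) (hy : y ∈ supp π.blocks) :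
    numBlocksLeft π.blocks x = numBlocksLeft π.blocks y ↔ SameBlock π.blocks x y := by
  have hS : IsBlockFamily π.blocks := π.2.2.1
  have hsame : ∀ {x y}, SameBlock π.blocks x y →
      numBlocksLeft π.blocks x ≤ numBlocksLeft π.blocks y := by
    rintro x y ⟨b, hb, hxb, hyb⟩
    refine Finset.card_le_card (Finset.monotone_filter_right _ fun d hd h => ?_)
    have hdb : d ≠ b := by
      rintro rfl
      exact lt_irrefl _ (h x hxb)
    obtain ⟨w, hw⟩ := hS.nonempty_of_mem hd
    rcases hπ.lt_or_lt hd hb hdb with h' | h'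
    · exact fun w hw => h' w hw y hyb
    · exact absurd (h w hw) (by have := h' w hw x hxb; omega)
  have hlt : ∀ {x y}, x ∈ supp π.blocks → y ∈ supp π.blocks → x < y →
      ¬ SameBlock π.blocks x y → numBlocksLeft π.blocks x ≠ numBlocksLeft π.blocks y := by
    intro x y hx hy hxy hnot
    refine (Finset.card_lt_card ?_).ne
    refine (Finset.ssubset_iff_of_subset
      (Finset.monotone_filter_right _ fun _ _ h w hw => (h w hw).trans hxy)).2 ?_
    obtain ⟨b, hb, hxb⟩ := mem_supp.1 hx
    obtain ⟨b', hb', hyb'⟩ := mem_supp.1 hy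
    have hne : b ≠ b' := by
      rintro rfl
      exact hnot ⟨b, hb, hxb, hyb'⟩
    refine ⟨b, Finset.mem_filter.2 ⟨hb, fun w hw => ?_⟩, fun h => ?_⟩
    · rcases hπ.lt_or_lt hb hb' hne with h | h
      · exact h w hw y hyb'
      · exact absurd (h x hxb y hyb') (by omega)
    · exact lt_irrefl _ ((Finset.mem_filter.1 h).2 x hxb)
  refine ⟨fun h => ?_, fun h => (hsame h).antisymm (hsame h.symm)⟩
  by_contra hnot
  rcases lt_trichotomy x y with hxy | rfl | hxy
  · exact hlt hx hy hxy hnot h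
  · exact hnot (sameBlock_self hx)
  · exact hlt hy hx hxy (fun h => hnot h.symm) h.symm

lemma image_numBlocksLeft :
    (supp π.blocks).image (numBlocksLeft π.blocks) = Finset.range π.numBlocks := by
  have hS : IsBlockFamily π.blocks := π.2.2.1
  apply Finset.eq_of_subset_of_card_le
  · intro r hr
    obtain ⟨x, hx, rfl⟩ := Finset.mem_image.1 hr
    obtain ⟨b, hb, hxb⟩ := mem_supp.1 hx
    rw [Finset.mem_range]
    refine Finset.card_lt_card ((Finset.ssubset_iff_of_subset (Finset.filter_subset _ _)).2
      ⟨b, hb, fun h => lt_irrefl _ ((Finset.mem_filter.1 h).2 x hxb)⟩)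
  · rw [Finset.card_range, NCPartition.numBlocks]
    have hex : ∀ b, ∃ x, b ∈ π.blocks → x ∈ b := fun b => by
      by_cases hb : b ∈ π.blocks
      · exact (hS.nonempty_of_mem hb).imp fun x hx _ => hx
      · exact ⟨0, fun h => absurd h hb⟩
    choose p hp using hex
    have hsupp : ∀ b ∈ π.blocks, p b ∈ supp π.blocks := fun b hb => mem_supp.2 ⟨b, hb, hp b hb⟩
    refine Finset.card_le_card_of_injOn (fun b => numBlocksLeft π.blocks (p b))
      (fun b hb => Finset.mem_image_of_mem _ (hsupp b hb)) fun b hb b' hb' h => ?_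
    obtain ⟨d, hd, h1, h2⟩ := (hπ.numBlocksLeft_eq_iff (hsupp b hb) (hsupp b' hb')).1 h
    exact (hS.eq_of_mem hb hd (hp b hb) h1).trans (hS.eq_of_mem hb' hd (hp b' hb') h2).symm

/-- The map `numBlocksLeft` collapses each block to one point, which `numLevel_eq_of_monotoneOn`
allows. -/
theorem numLevel_eq (N : ℕ) :
    numLevel π.blocks N = numLevel (singletons (Finset.range π.numBlocks)) N := by
  refine numLevel_eq_of_monotoneOn (numBlocksLeft π.blocks)
    (fun x _ y _ hxy => numBlocksLeft_mono _ hxy) ?_ (fun x hx y hy => ?_) N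
  · rw [hπ.image_numBlocksLeft, supp_singletons]
  · rw [sameBlock_singletons, hπ.numBlocksLeft_eq_iff hx hy, ← hπ.image_numBlocksLeft]
    exact (and_iff_right (Finset.mem_image_of_mem _ hx)).symm

end NCPartition.NestingFree

/-! ## The recursion for partitions into singletons -/

/-- The subsets of `{0, …, n - 1}` without consecutive elements. -/
def sparseSets (n : ℕ) : Finset (Finset ℕ) :=
  (Finset.range n).powerset.filter fun J => ∀ x ∈ J, x + 1 ∉ J

lemma mem_sparseSets {n : ℕ} {J : Finset ℕ} :
    J ∈ sparseSets n ↔ (∀ x ∈ J, x < n) ∧ ∀ x ∈ J, x + 1 ∉ J := by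
  simp [sparseSets, Finset.subset_iff]

/-- Split by whether the largest element `n + 1` belongs to `J`; if it does, `n` does not, and
removing `n + 1` leaves a sparse subset of `{0, …, n - 1}`. -/
lemma card_sparseSets_succ_succ (n j : ℕ) :
    ((sparseSets (n + 2)).filter fun J => J.card = j + 1).card =
      ((sparseSets (n + 1)).filter fun J => J.card = j + 1).card +
        ((sparseSets n).filter fun J => J.card = j).card := by
  rw [← Finset.card_filter_add_card_filter_not (fun J : Finset ℕ => n + 1 ∉ J)]
  congr 1
  · congr 1
    ext J
    simp only [Finset.mem_filter, mem_sparseSets]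
    constructor
    · rintro ⟨⟨⟨h1, h2⟩, h3⟩, h4⟩
      refine ⟨⟨fun x hx => ?_, h2⟩, h3⟩
      have : x ≠ n + 1 := fun h => h4 (h ▸ hx)
      have := h1 x hx
      omega
    · rintro ⟨⟨h1, h2⟩, h3⟩
      exact ⟨⟨⟨fun x hx => (h1 x hx).trans (by omega), h2⟩, h3⟩,
        fun h => absurd (h1 _ h) (by omega)⟩
  · refine Finset.card_nbij' (fun J => J.erase (n + 1)) (fun J => insert (n + 1) J) ?_ ?_ ?_ ?_
    · intro J hJ
      simp only [Finset.mem_coe, Finset.mem_filter, mem_sparseSets, not_not] at hJ ⊢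
      obtain ⟨⟨⟨h1, h2⟩, h3⟩, h4⟩ := hJ
      refine ⟨⟨fun x hx => ?_, fun x hx hx' => ?_⟩, ?_⟩
      · rw [Finset.mem_erase] at hx
        have h5 := h1 x hx.2
        have h6 : x ≠ n := fun h => h2 x hx.2 (h ▸ h4)
        omega
      · exact h2 x (Finset.mem_of_mem_erase hx) (Finset.mem_of_mem_erase hx')
      · rw [Finset.card_erase_of_mem h4, h3, Nat.add_sub_cancel]
    · intro J hJ
      simp only [Finset.mem_coe, Finset.mem_filter, mem_sparseSets, not_not] at hJ ⊢
      obtain ⟨⟨h1, h2⟩, h3⟩ := hJ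
      refine ⟨⟨⟨fun x hx => ?_, fun x hx hx' => ?_⟩, ?_⟩, Finset.mem_insert_self _ _⟩
      · rcases Finset.mem_insert.1 hx with rfl | hx
        · omega
        · exact (h1 x hx).trans (by omega)
      · rcases Finset.mem_insert.1 hx with rfl | hx <;>
          rcases Finset.mem_insert.1 hx' with h | hx'
        · omega
        · exact absurd (h1 _ hx') (by omega)
        · exact absurd (h1 _ hx) (by omega)
        · exact h2 x hx hx'
      · rw [Finset.card_insert_of_notMem fun h => absurd (h1 _ h) (by omega), h3]
    · intro J hJ
      simp only [Finset.mem_coe, Finset.mem_filter, not_not] at hJ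
      exact Finset.insert_erase hJ.2
    · intro J hJ
      simp only [Finset.mem_coe, Finset.mem_filter, mem_sparseSets] at hJ
      exact Finset.erase_insert fun h => absurd (hJ.1.1 _ h) (by omega)

lemma card_sparseSets_filter_card (n j : ℕ) :
    ((sparseSets n).filter fun J => J.card = j).card = (n + 1 - j).choose j := by
  have hj0 : ∀ n, ((sparseSets n).filter fun J => J.card = 0).card = 1 := by
    intro n
    rw [Finset.card_eq_one]
    refine ⟨∅, Finset.ext fun J => ?_⟩
    rw [Finset.mem_filter, Finset.card_eq_zero, Finset.mem_singleton, mem_sparseSets]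
    refine and_iff_right_of_imp ?_
    rintro rfl
    simp
  induction n using Nat.twoStepInduction generalizing j with
  | zero =>
    have h : sparseSets 0 = {∅} := by decide
    rcases j with _ | j
    · simpa using hj0 _
    · simp [h, Finset.filter_singleton]
  | one =>
    have h : sparseSets 1 = {∅, {0}} := by decide
    rcases j with _ | _ | j
    · simpa using hj0 _
    · simp [h, Finset.filter_insert, Finset.filter_singleton]
    · simp [h, Finset.filter_insert, Finset.filter_singleton]
  | more n ih1 ih2 =>
    rcases j with _ | j
    · simpa using hj0 _
    · rw [card_sparseSets_succ_succ, ih1, ih2]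
      -- In the range `j ≤ n + 1` this is Pascal's rule; otherwise the truncated differences are `0`
      -- and all the binomial coefficients vanish.
      by_cases hj : j ≤ n + 1
      · rw [show n + 2 + 1 - (j + 1) = (n + 1 - j) + 1 by omega, Nat.choose_succ_succ,
          show n + 1 + 1 - (j + 1) = n + 1 - j by omega, add_comm]
      · rw [show n + 2 + 1 - (j + 1) = 0 by omega, show n + 1 + 1 - (j + 1) = 0 by omega,
          show n + 1 - j = 0 by omega, Nat.choose_eq_zero_of_lt (by omega),
          Nat.choose_eq_zero_of_lt (by omega)]

/-- `N` is the largest color available. Two neighbors of color `N` have nothing between them to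
separate them; if there are no such neighbors, the point just after one of color `N` separates it
from the next. A separator of two smaller equal colors has an even smaller color, so it lies outside
`J`. -/
lemma isLevelColoring_singletons_range_iff {n N : ℕ} {c : ℕ → ℕ}
    (hc : ∀ x ∈ Finset.range n, c x < N + 1) {J : Finset ℕ}
    (hJ : (Finset.range n).filter (fun x => c x = N) = J) :
    IsLevelColoring (singletons (Finset.range n)) c ↔
      J ∈ sparseSets n ∧ IsLevelColoring (singletons (Finset.range n \ J)) c := by
  have hmem : ∀ {x}, x ∈ J ↔ x < n ∧ c x = N := by
    intro x
    rw [← hJ, Finset.mem_filter, Finset.mem_range]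
  rw [isLevelColoring_singletons, isLevelColoring_singletons, mem_sparseSets]
  simp only [Finset.mem_sdiff, hmem, Finset.mem_range] at hc ⊢
  constructor
  · refine fun h => ⟨⟨fun x hx => hx.1, fun x hx hx' => ?_⟩, fun x hx y hy hxy hxy' => ?_⟩
    · obtain ⟨z, -, h1, h2, -⟩ := h x hx.1 (x + 1) hx'.1 (by omega) (by omega)
      omega
    · obtain ⟨z, hz, h1, h2, h3⟩ := h x hx.1 y hy.1 hxy hxy'
      have := hc x hx.1
      exact ⟨z, ⟨hz, by omega⟩, h1, h2, h3⟩
  · rintro ⟨⟨-, h1⟩, h2⟩ x hx y hy hxy hxy'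
    by_cases hxN : c x = N
    · have h3 := h1 x ⟨hx, hxN⟩
      have h4 : x + 1 ≠ y := by
        rintro rfl
        exact h3 ⟨hy, by omega⟩
      have := hc (x + 1) (by omega)
      exact ⟨x + 1, by omega, by omega, by omega, by omega⟩
    · obtain ⟨z, hz, h⟩ := h2 x ⟨hx, by omega⟩ y ⟨hy, by omega⟩ hxy hxy'
      exact ⟨z, hz.1, h⟩

lemma card_singletons_fiber {n : ℕ} (N : ℕ) {J : Finset ℕ} (hJ : J ∈ sparseSets n) :
    ((levelColorings (singletons (Finset.range n)) (N + 1)).filter fun c : ℕ →₀ ℕ =>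
        (Finset.range n).filter (fun x => c x = N) = J).card =
      numLevel (singletons (Finset.range n \ J)) N := by
  have hJn := (mem_sparseSets.1 hJ).1
  refine Finset.card_nbij' (fun c => extendZero (Finset.range n \ J) c)
    (fun d => extendZero (Finset.range n) fun x => if x ∈ J then N else d x) ?_ ?_ ?_ ?_
  · intro c hc
    simp only [Finset.mem_coe, Finset.mem_filter, mem_levelColorings, supp_singletons,
      extendZero_mem_colorings] at hc ⊢
    obtain ⟨⟨h1, h2⟩, h3⟩ := hc
    rw [isLevelColoring_singletons_range_iff (mem_colorings.1 h1).2 h3] at h2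
    refine ⟨fun x hx => ?_, h2.2.congr fun x hx => ?_⟩
    · rw [← h3, Finset.mem_sdiff, Finset.mem_filter] at hx
      have := (mem_colorings.1 h1).2 x hx.1
      have : c x ≠ N := fun h => hx.2 ⟨hx.1, h⟩
      omega
    · rw [extendZero_apply (by rwa [supp_singletons] at hx)]
  · intro d hd
    simp only [Finset.mem_coe, Finset.mem_filter, mem_levelColorings, supp_singletons,
      extendZero_mem_colorings] at hd ⊢
    obtain ⟨h1, h2⟩ := hd
    have hlt : ∀ x ∈ Finset.range n, (if x ∈ J then N else d x) < N + 1 := by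
      intro x hx
      split_ifs with hxJ
      · omega
      · exact ((mem_colorings.1 h1).2 x (Finset.mem_sdiff.2 ⟨hx, hxJ⟩)).trans (by omega)
    have hfil : (Finset.range n).filter (fun x => (if x ∈ J then N else d x) = N) = J := by
      ext x
      rw [Finset.mem_filter]
      constructor
      · rintro ⟨hx, h⟩
        by_contra hxJ
        rw [if_neg hxJ] at h
        have := (mem_colorings.1 h1).2 x (Finset.mem_sdiff.2 ⟨hx, hxJ⟩)
        omega
      · intro hx
        exact ⟨Finset.mem_range.2 (hJn x hx), if_pos hx⟩
    have hlev : IsLevelColoring (singletons (Finset.range n))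
        fun x => if x ∈ J then N else d x := by
      rw [isLevelColoring_singletons_range_iff hlt hfil]
      refine ⟨hJ, h2.congr fun x hx => ?_⟩
      rw [supp_singletons] at hx
      rw [if_neg (Finset.mem_sdiff.1 hx).2]
    refine ⟨⟨hlt, hlev.congr fun x hx => ?_⟩, ?_⟩
    · rw [extendZero_apply (by rwa [supp_singletons] at hx)]
    · rw [← hfil]
      refine Finset.filter_congr fun x hx => ?_
      rw [extendZero_apply hx, hfil]
  · intro c hc
    simp only [Finset.mem_coe, Finset.mem_filter, mem_levelColorings, supp_singletons] at hc
    obtain ⟨⟨h1, h2⟩, h3⟩ := hc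
    have : ∀ x ∈ Finset.range n,
        (if x ∈ J then N else (extendZero (Finset.range n \ J) c) x) = c x := by
      intro x hx
      split_ifs with hxJ
      · rw [← h3, Finset.mem_filter] at hxJ
        exact hxJ.2.symm
      · rw [extendZero_apply (Finset.mem_sdiff.2 ⟨hx, hxJ⟩)]
    refine colorings_ext (N := N + 1) (extendZero_mem_colorings.2 fun x hx => ?_) h1
      fun x hx => ?_
    · rw [this x hx]; exact (mem_colorings.1 h1).2 x hx
    · rw [extendZero_apply hx]; exact this x hx
  · intro d hd
    simp only [Finset.mem_coe, mem_levelColorings, supp_singletons] at hd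
    have : ∀ x ∈ Finset.range n \ J,
        (extendZero (Finset.range n) fun x => if x ∈ J then N else d x) x = d x := by
      intro x hx
      rw [Finset.mem_sdiff] at hx
      rw [extendZero_apply hx.1, if_neg hx.2]
    refine colorings_ext (N := N) (extendZero_mem_colorings.2 fun x hx => ?_) hd.1
      fun x hx => ?_
    · rw [this x hx]; exact (mem_colorings.1 hd.1).2 x hx
    · rw [extendZero_apply hx]; exact this x hx

/-- Colorings are sorted by the set `J` of points of the largest color `N`. The other `l = n - |J|`
points form a level coloring with `N` colors, and the coefficient counts the sparse sets of size `n
- l`. -/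
theorem numLevel_singletons_range_succ (n N : ℕ) :
    numLevel (singletons (Finset.range n)) (N + 1) = ∑ l ∈ Finset.range (n + 1),
      (l + 1).choose (n - l) * numLevel (singletons (Finset.range l)) N := by
  rw [numLevel, Finset.card_eq_sum_card_fiberwise (f := fun c : ℕ →₀ ℕ =>
    (Finset.range n).filter (fun x => c x = N)) (t := sparseSets n)]
  · have h1 : ∀ J ∈ sparseSets n, ((levelColorings (singletons (Finset.range n)) (N + 1)).filter
        fun c : ℕ →₀ ℕ => (Finset.range n).filter (fun x => c x = N) = J).card =
        numLevel (singletons (Finset.range (n - J.card))) N := by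
      intro J hJ
      rw [card_singletons_fiber N hJ, numLevel_singletons, Finset.card_sdiff_of_subset,
        Finset.card_range]
      exact fun x hx => Finset.mem_range.2 ((mem_sparseSets.1 hJ).1 x hx)
    -- The right-hand side is reindexed by `j = n - l`, which is the size of `J`.
    rw [Finset.sum_congr rfl h1, ← Finset.sum_flip, ← Finset.sum_fiberwise_of_maps_to
      (t := Finset.range (n + 1)) (g := Finset.card)]
    · refine Finset.sum_congr rfl fun j hj => ?_
      rw [Finset.mem_range] at hj
      rw [Finset.sum_congr rfl (g := fun _ => numLevel (singletons (Finset.range (n - j))) N)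
        fun J hJ => by rw [(Finset.mem_filter.1 hJ).2], Finset.sum_const, smul_eq_mul,
        card_sparseSets_filter_card, Nat.sub_sub_self (by omega),
        Nat.sub_add_comm (by omega)]
    · intro J hJ
      rw [Finset.mem_range, Nat.lt_succ_iff]
      refine (Finset.card_le_card fun x hx => ?_).trans (Finset.card_range n).le
      exact Finset.mem_range.2 ((mem_sparseSets.1 hJ).1 x hx)
  · intro c hc
    have hc := mem_levelColorings.1 hc
    rw [supp_singletons] at hc
    exact ((isLevelColoring_singletons_range_iff (mem_colorings.1 hc.1).2 rfl).1 hc.2).1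

/-! ### Small numbers of colors, and the first column of the powers of the Riordan array. -/

lemma numLevel_zero {S : Finset (Finset ℕ)} (hS : (supp S).Nonempty) : numLevel S 0 = 0 := by
  rw [numLevel, Finset.card_eq_zero, Finset.eq_empty_iff_forall_notMem]
  intro c hc
  obtain ⟨x, hx⟩ := hS
  exact absurd ((mem_colorings.1 (mem_levelColorings.1 hc).1).2 x hx) (by omega)

lemma mem_colorings_empty {N : ℕ} {c : ℕ →₀ ℕ} : c ∈ colorings ∅ N ↔ c = 0 := by
  simp [mem_colorings, Finsupp.ext_iff]

lemma numLevel_empty (N : ℕ) : numLevel ∅ N = 1 := by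
  rw [numLevel, Finset.card_eq_one]
  refine ⟨0, Finset.ext fun c => ?_⟩
  rw [mem_levelColorings, Finset.mem_singleton]
  change c ∈ colorings ∅ N ∧ _ ↔ _
  rw [mem_colorings_empty]
  exact and_iff_left fun x hx => absurd hx (Finset.notMem_empty x)

/-- The constant coloring relates any two points, so it is a level coloring exactly when there is a
single block. -/
lemma NCPartition.numLevel_one (π : NCPartition) :
    numLevel π.blocks 1 = if π.numBlocks = 1 then 1 else 0 := by
  have hS : IsBlockFamily π.blocks := π.2.2.1
  have h0 : ∀ {c : ℕ →₀ ℕ} {U : Finset ℕ}, c ∈ colorings U 1 ↔ c = 0 := by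
    intro c U
    simp only [mem_colorings, Nat.lt_one_iff, Finsupp.ext_iff, Finsupp.coe_zero, Pi.zero_apply]
    exact ⟨fun h x => if hx : x ∈ U then h.2 x hx else h.1 x hx,
      fun h => ⟨fun x _ => h x, fun x _ => h x⟩⟩
  have hiff : IsLevelColoring π.blocks (fun _ => 0) ↔ π.numBlocks = 1 := by
    constructor
    · intro h
      refine le_antisymm (Finset.card_le_one.2 fun b hb b' hb' => ?_)
        (Finset.card_pos.2 π.2.1)
      obtain ⟨x, hx⟩ := hS.nonempty_of_mem hb
      obtain ⟨y, hy⟩ := hS.nonempty_of_mem hb'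
      have hxy : SameBlock π.blocks x y := by
        have hx' := mem_supp.2 ⟨b, hb, hx⟩
        have hy' := mem_supp.2 ⟨b', hb', hy⟩
        rcases lt_trichotomy x y with hxy | rfl | hxy
        · exact (h x hx' y hy' hxy).2 ⟨rfl, fun _ _ _ _ => le_rfl⟩
        · exact sameBlock_self hx'
        · exact ((h y hy' x hx' hxy).2 ⟨rfl, fun _ _ _ _ => le_rfl⟩).symm
      obtain ⟨d, hd, h1, h2⟩ := hxy
      exact (hS.eq_of_mem hb hd hx h1).trans (hS.eq_of_mem hb' hd hy h2).symm
    · intro h x hx y hy hxy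
      refine iff_of_true ?_ ⟨rfl, fun _ _ _ _ => le_rfl⟩
      obtain ⟨b, hb⟩ := Finset.card_eq_one.1 h
      obtain ⟨d, hd, hxd⟩ := mem_supp.1 hx
      obtain ⟨d', hd', hyd'⟩ := mem_supp.1 hy
      have hdd : d' = d := Finset.card_le_one.1 h.le d' hd' d hd
      exact ⟨d, hd, hxd, hdd ▸ hyd'⟩
  rw [numLevel]
  split_ifs with h
  · rw [Finset.card_eq_one]
    refine ⟨0, Finset.ext fun c => ?_⟩
    rw [mem_levelColorings, Finset.mem_singleton, h0]
    refine and_iff_left_of_imp ?_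
    rintro rfl
    exact hiff.2 h
  · rw [Finset.card_eq_zero, Finset.eq_empty_iff_forall_notMem]
    intro c hc
    rw [mem_levelColorings, h0] at hc
    obtain ⟨rfl, hc⟩ := hc
    exact h (hiff.1 hc)

/-- The recursion in the number of colors is multiplication by the matrix. With no colors only the
empty partition can be colored, which gives the first column of the identity. -/
theorem entry_riordanM_pow (R : Type*) [CommRing R] (n N : ℕ) :
    (riordanM R ^ N).entry n 0 = (numLevel (singletons (Finset.range n)) N : R) := by
  induction N generalizing n with
  | zero =>
    rw [pow_zero, LowerTri.entry_one]
    split_ifs with h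
    · subst h
      have : singletons (Finset.range 0) = ∅ := rfl
      rw [this, numLevel_empty, Nat.cast_one]
    · rw [numLevel_zero, Nat.cast_zero]
      rw [supp_singletons]
      exact ⟨0, Finset.mem_range.2 (Nat.pos_of_ne_zero h)⟩
  | succ N ih =>
    rw [pow_succ', LowerTri.entry_mul_range _ _ (Nat.lt_succ_self n),
      numLevel_singletons_range_succ, Nat.cast_sum]
    refine Finset.sum_congr rfl fun l hl => ?_
    rw [ih, entry_riordanM, if_pos (Nat.lt_succ_iff.1 (Finset.mem_range.1 hl)), Nat.cast_mul]

/-! ## Polynomiality -/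

lemma NCPartition.isBlockFamily_blocks (π : NCPartition) : IsBlockFamily π.blocks := π.2.2.1

lemma NCPartition.isNoncrossing_blocks (π : NCPartition) : IsNoncrossing π.blocks := π.2.2.2.2

section Polynomiality

open Polynomial

variable {K : Type*} [Field K] [CharZero K]

lemma exists_eval_eq_sum_pow (d : ℕ) :
    ∃ q : K[X], ∀ n : ℕ, q.eval (n : K) = ∑ i ∈ Finset.range n, (i : K) ^ d := by
  refine ⟨((∑ i ∈ Finset.range (d + 1), Polynomial.monomial (d + 1 - i)
    (_root_.bernoulli i * ((d + 1).choose i : ℚ) / (d + 1 : ℚ)) : ℚ[X])).map (algebraMap ℚ K),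
    fun n => ?_⟩
  have h := congrArg (algebraMap ℚ K) (sum_range_pow n d)
  simp only [map_sum, map_pow, map_natCast] at h
  rw [h, eval_map, eval₂_finsetSum]
  refine Finset.sum_congr rfl fun i _ => ?_
  rw [eval₂_monomial]
  simp only [map_mul, map_div₀, map_pow, map_natCast]
  ring

lemma exists_eval_eq_sum (p : K[X]) :
    ∃ q : K[X], ∀ n : ℕ, q.eval (n : K) = ∑ i ∈ Finset.range n, p.eval (i : K) := by
  induction p using Polynomial.induction_on' with
  | add p q hp hq =>
    obtain ⟨p', hp'⟩ := hp
    obtain ⟨q', hq'⟩ := hq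
    exact ⟨p' + q', fun n => by simp [hp', hq', Finset.sum_add_distrib]⟩
  | monomial d a =>
    obtain ⟨q, hq⟩ := exists_eval_eq_sum_pow (K := K) d
    exact ⟨C a * q, fun n => by simp [hq, Finset.mul_sum]⟩

variable (K) in
/-- The number of level colorings is polynomial in the number of colors. -/
lemma exists_eval_eq_numLevel {S : Finset (Finset ℕ)} (hS : IsBlockFamily S)
    (hS' : IsNoncrossing S) : ∃ q : K[X], ∀ n : ℕ, q.eval (n : K) = numLevel S n := by
  induction hm : S.card using Nat.strong_induction_on generalizing S with
  | _ m ih =>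
    rcases S.eq_empty_or_nonempty with rfl | hne
    · exact ⟨1, fun n => by simp [numLevel_empty]⟩
    let π : NCPartition := ⟨standardize S, isNCPartition_standardize hne hS hS'⟩
    have hcard : π.blocks.card ≤ m := hm ▸ Finset.card_image_le
    have hsub : ∀ J ∈ π.blocks.powerset.erase ∅,
        ∃ q : K[X], ∀ n : ℕ, q.eval (n : K) = numLevel (π.blocks \ J) n := by
      intro J hJ
      rw [Finset.mem_erase, Finset.mem_powerset] at hJ
      refine ih _ ?_ (π.2.2.1.mono Finset.sdiff_subset) (π.2.2.2.2.mono Finset.sdiff_subset) rfl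
      refine (Finset.card_lt_card ?_).trans_le hcard
      exact Finset.sdiff_ssubset hJ.2 (Finset.nonempty_iff_ne_empty.2 hJ.1)
    choose! q hq using hsub
    classical
    -- By `numLevel_add` with one additional color, the ideal `∅` contributes the previous count and
    -- every other ideal leaves fewer blocks. So the first difference is polynomial by induction,
    -- and `p` is its discrete antiderivative.
    obtain ⟨p, hp⟩ := exists_eval_eq_sum
      (∑ J ∈ (π.blocks.powerset.filter (IsNCIdeal π)).erase ∅,
        q J * C ((∏ C ∈ components (supp J), numLevel (J.filter (· ⊆ C)) 1 : ℕ) : K))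
    have hempty : IsNCIdeal π ∅ := by
      refine ⟨Finset.empty_subset _, fun C hC => absurd hC ?_⟩
      simp [supp, components]
    have hstep : ∀ n, (numLevel π.blocks (n + 1) : K) = numLevel π.blocks n +
        ∑ J ∈ (π.blocks.powerset.filter (IsNCIdeal π)).erase ∅, (numLevel (π.blocks \ J) n : K) *
          ((∏ C ∈ components (supp J), numLevel (J.filter (· ⊆ C)) 1 : ℕ) : K) := by
      intro n
      have hmem : ∅ ∈ π.blocks.powerset.filter (IsNCIdeal π) :=
        Finset.mem_filter.2 ⟨Finset.empty_mem_powerset _, hempty⟩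
      rw [numLevel_add, ← Finset.add_sum_erase _ _ hmem]
      push_cast
      congr 1
      simp [supp, components]
    refine ⟨C (numLevel π.blocks 0 : K) + p, fun n => ?_⟩
    rw [← numLevel_standardize S]
    change _ = (numLevel π.blocks n : K)
    rw [eval_add, eval_C, hp]
    induction n with
    | zero => simp
    | succ n ihn =>
      rw [Finset.sum_range_succ, ← add_assoc, ihn, hstep, eval_finsetSum]
      congr 1
      refine Finset.sum_congr rfl fun J hJ => ?_
      rw [eval_mul, eval_C, hq J]
      rw [Finset.mem_erase, Finset.mem_filter] at hJ
      exact Finset.mem_erase.2 ⟨hJ.1, hJ.2.1⟩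

end Polynomiality

/-! ## The morphism to polynomials -/

section Morphism

open Polynomial

variable (K : Type*) [Field K] [CharZero K]

/-- The polynomial counting the level colorings of a noncrossing partition. -/
def levelPolynomial (π : NCPartition) : K[X] :=
  (exists_eval_eq_numLevel K π.2.2.1 π.2.2.2.2).choose

lemma eval_levelPolynomial (π : NCPartition) (n : ℕ) :
    (levelPolynomial K π).eval (n : K) = numLevel π.blocks n :=
  (exists_eval_eq_numLevel K π.2.2.1 π.2.2.2.2).choose_spec n

/-- The algebra morphism which sends a noncrossing partition to the polynomial counting its level
colorings. -/
def levelHom : NCAlg K →ₐ[K] K[X] := MvPolynomial.aeval (levelPolynomial K)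

lemma eval_levelHom_X (π : NCPartition) (n : ℕ) :
    (levelHom K (MvPolynomial.X π)).eval (n : K) = numLevel π.blocks n := by
  rw [levelHom, MvPolynomial.aeval_X, eval_levelPolynomial]

lemma eval_levelHom_ofBlocks {S : Finset (Finset ℕ)} (hS : S = ∅ ∨ IsNCPartition S) (n : ℕ) :
    (levelHom K (ofBlocks K S)).eval (n : K) = numLevel S n := by
  by_cases h : IsNCPartition S
  · exact (congrArg (fun a => (levelHom K a).eval (n : K)) (dif_pos h)).trans
      (eval_levelHom_X K ⟨S, h⟩ n)
  · rw [ofBlocks, dif_neg h, map_one, eval_one, hS.resolve_right h, numLevel_empty, Nat.cast_one]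

lemma eval_levelHom_restr {S : Finset (Finset ℕ)} (hS : IsBlockFamily S) (hS' : IsNoncrossing S)
    (n : ℕ) : (levelHom K (restr K S)).eval (n : K) = numLevel S n := by
  rw [restr, eval_levelHom_ofBlocks, numLevel_standardize]
  rcases S.eq_empty_or_nonempty with rfl | hne
  · exact Or.inl rfl
  · exact Or.inr (isNCPartition_standardize hne hS hS')

variable {K}

-- The tensor square is read as polynomials with coefficients in `K[X]`: evaluating first the outer
-- and then the inner variable recovers the pair of evaluations on the two factors.
omit [CharZero K] in
lemma polyEquivTensor_symm_eval_eval (x y : K) (t : K[X] ⊗[K] K[X]) :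
    (((polyEquivTensor K K[X]).symm t).eval (C y)).eval x =
      Algebra.TensorProduct.lift (aeval x) (aeval y) (fun _ _ => Commute.all _ _) t := by
  induction t using TensorProduct.induction_on with
  | zero => simp
  | add a b ha hb => rw [map_add, map_add, eval_add, eval_add, ha, hb]
  | tmul a b =>
    rw [polyEquivTensor_symm_apply_tmul_eq_smul, Algebra.TensorProduct.lift_tmul, eval_smul,
      smul_eq_mul, eval_mul, coe_aeval_eq_eval, coe_aeval_eq_eval]
    congr 1
    simp

/-- An element of `𝕂[X] ⊗ 𝕂[X]` is determined by its values at pairs of positive integers. -/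
lemma tensor_ext_eval {s t : K[X] ⊗[K] K[X]}
    (h : ∀ n m : ℕ, 0 < m →
      Algebra.TensorProduct.lift (aeval (n : K)) (aeval (m : K)) (fun _ _ => Commute.all _ _) s =
      Algebra.TensorProduct.lift (aeval (n : K)) (aeval (m : K)) (fun _ _ => Commute.all _ _) t) :
    s = t := by
  apply (polyEquivTensor K K[X]).symm.injective
  -- Positive integers suffice for the second variable, as there are infinitely many. This matters
  -- because `numLevel_mul` divides by `M` and needs `0 < M`.
  refine Polynomial.eq_of_infinite_eval_eq _ _ (Set.Infinite.mono ?_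
    (Set.infinite_range_of_injective (f := fun m : ℕ => (C ((m + 1 : ℕ) : K) : K[X])) ?_))
  · rintro _ ⟨m, rfl⟩
    refine Polynomial.eq_of_eval_natCast_eq fun n => ?_
    rw [polyEquivTensor_symm_eval_eval, polyEquivTensor_symm_eval_eval]
    exact h n (m + 1) m.succ_pos
  · intro m m' hm
    simpa using C_injective hm

omit [CharZero K] in
lemma lift_eval_polyDelta (x y : K) (p : K[X]) :
    Algebra.TensorProduct.lift (aeval x) (aeval y) (fun _ _ => Commute.all _ _) (polyDelta K p) =
      p.eval (x + y) := by
  have : (Algebra.TensorProduct.lift (aeval x) (aeval y) fun _ _ => Commute.all _ _).comp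
      (polyDelta K) = aeval (x + y) := by
    ext
    simp [polyDelta]
  rw [← coe_aeval_eq_eval, ← this]
  rfl

omit [CharZero K] in
lemma lift_eval_polydelta (x y : K) (p : K[X]) :
    Algebra.TensorProduct.lift (aeval x) (aeval y) (fun _ _ => Commute.all _ _) (polydelta K p) =
      p.eval (x * y) := by
  have : (Algebra.TensorProduct.lift (aeval x) (aeval y) fun _ _ => Commute.all _ _).comp
      (polydelta K) = aeval (x * y) := by
    ext
    simp [polydelta]
  rw [← coe_aeval_eq_eval, ← this]
  rfl

-- After evaluation at natural numbers, the four axioms are `numLevel_add`, `numLevel_zero`,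
-- `numLevel_mul` and `NCPartition.numLevel_one`.
variable (K) in
theorem isDoubleBialgebraHom_levelHom : IsDoubleBialgebraHom (levelHom K) where
  map_Delta := by
    classical
    refine MvPolynomial.algHom_ext fun π => tensor_ext_eval fun n m _ => ?_
    rw [AlgHom.comp_apply, AlgHom.comp_apply, lift_eval_polyDelta, ncDelta, MvPolynomial.aeval_X,
      levelHom, MvPolynomial.aeval_X, ← levelHom, ← Nat.cast_add, eval_levelPolynomial,
      numLevel_add, map_sum, map_sum, Nat.cast_sum]
    refine Finset.sum_congr rfl fun J hJ => ?_
    have hJ' : J ⊆ π.blocks := Finset.mem_powerset.1 (Finset.mem_filter.1 hJ).1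
    rw [Algebra.TensorProduct.map_tmul, Algebra.TensorProduct.lift_tmul, coe_aeval_eq_eval,
      coe_aeval_eq_eval, eval_levelHom_restr K (π.isBlockFamily_blocks.mono Finset.sdiff_subset)
        (π.isNoncrossing_blocks.mono Finset.sdiff_subset), restrComponents, map_prod, eval_prod, Nat.cast_mul,
      Nat.cast_prod]
    congr 1
    refine Finset.prod_congr rfl fun C _ => ?_
    have hsub : J.filter (· ⊆ C) ⊆ π.blocks := (Finset.filter_subset _ _).trans hJ'
    rw [eval_levelHom_restr K (π.isBlockFamily_blocks.mono hsub) (π.isNoncrossing_blocks.mono hsub)]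
  counit_Delta := by
    refine MvPolynomial.algHom_ext fun π => ?_
    rw [AlgHom.comp_apply, levelHom, MvPolynomial.aeval_X, ncCounitDelta, MvPolynomial.aeval_X,
      coe_aeval_eq_eval, ← Nat.cast_zero, eval_levelPolynomial, numLevel_zero]
    obtain ⟨b, hb⟩ := π.2.1
    obtain ⟨x, hx⟩ := π.isBlockFamily_blocks.nonempty_of_mem hb
    exact ⟨x, mem_supp.2 ⟨b, hb, hx⟩⟩
  map_delta := by
    classical
    refine MvPolynomial.algHom_ext fun π => tensor_ext_eval fun n m hm => ?_
    rw [AlgHom.comp_apply, AlgHom.comp_apply, lift_eval_polydelta, ncdelta, MvPolynomial.aeval_X,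
      levelHom, MvPolynomial.aeval_X, ← levelHom, ← Nat.cast_mul, eval_levelPolynomial,
      numLevel_mul π.isBlockFamily_blocks n hm, map_sum, map_sum, Nat.cast_sum]
    refine Finset.sum_congr rfl fun Q hQ => ?_
    have hQ := (Finset.mem_filter.1 hQ).2
    -- This ensures that `ofBlocks` gives the generator and not its default value `1`.
    have hfuse : IsNCPartition (fuse Q) := by
      refine ⟨?_, π.isBlockFamily_blocks.fuse Q, ?_, hQ⟩
      · exact (Q.parts_nonempty (Finset.nonempty_iff_ne_empty.1 π.2.1)).image _
      · rw [supp_fuse]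
        exact π.2.2.2.1
    rw [Algebra.TensorProduct.map_tmul, Algebra.TensorProduct.lift_tmul, coe_aeval_eq_eval,
      coe_aeval_eq_eval, eval_levelHom_ofBlocks K (Or.inr hfuse), map_prod, eval_prod,
      Nat.cast_mul, Nat.cast_prod]
    congr 1
    refine Finset.prod_congr rfl fun p hp => ?_
    rw [eval_levelHom_restr K (π.isBlockFamily_blocks.mono (Q.subset hp)) (π.isNoncrossing_blocks.mono (Q.subset hp))]
  counit_delta := by
    refine MvPolynomial.algHom_ext fun π => ?_
    rw [AlgHom.comp_apply, levelHom, MvPolynomial.aeval_X, ncCounitdelta, MvPolynomial.aeval_X,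
      coe_aeval_eq_eval, ← Nat.cast_one, eval_levelPolynomial, π.numLevel_one]
    split_ifs <;> simp

/-- The two counits fix the evaluations at `0` and `1`. Evaluating the first coproduct at the pair
`(n, 1)` expresses the value at `n + 1` through those at `n` and `1`, so two morphisms agree at all
natural numbers. -/
theorem IsDoubleBialgebraHom.unique {φ ψ : NCAlg K →ₐ[K] K[X]} (hφ : IsDoubleBialgebraHom φ)
    (hψ : IsDoubleBialgebraHom ψ) : φ = ψ := by
  have key : ∀ n : ℕ, ∀ a, (φ a).eval (n : K) = (ψ a).eval (n : K) := by
    intro n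
    induction n with
    | zero =>
      intro a
      have h := DFunLike.congr_fun (hφ.counit_Delta.trans hψ.counit_Delta.symm) a
      simpa [coe_aeval_eq_eval] using h
    | succ n ih =>
      intro a
      have h1 : ((aeval (1 : K)).comp φ : NCAlg K →ₐ[K] K) = (aeval (1 : K)).comp ψ :=
        hφ.counit_delta.trans hψ.counit_delta.symm
      have h2 : ((aeval (n : K)).comp φ : NCAlg K →ₐ[K] K) = (aeval (n : K)).comp ψ :=
        AlgHom.ext ih
      have hstep : ∀ {χ : NCAlg K →ₐ[K] K[X]}, IsDoubleBialgebraHom χ →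
          (χ a).eval ((n + 1 : ℕ) : K) =
            Algebra.TensorProduct.lift ((aeval (n : K)).comp χ) ((aeval (1 : K)).comp χ)
              (fun _ _ => Commute.all _ _) (ncDelta K a) := by
        intro χ hχ
        have h3 : (Algebra.TensorProduct.lift (aeval (n : K)) (aeval (1 : K))
            fun _ _ => Commute.all _ _).comp (Algebra.TensorProduct.map χ χ) =
            Algebra.TensorProduct.lift ((aeval (n : K)).comp χ) ((aeval (1 : K)).comp χ)
              (fun _ _ => Commute.all _ _) := by
          ext <;> simp
        rw [Nat.cast_succ, ← lift_eval_polyDelta, ← AlgHom.comp_apply (polyDelta K),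
          ← hχ.map_Delta, ← h3]
        rfl
      rw [hstep hφ, hstep hψ]
      congr 2
  exact AlgHom.ext fun a => Polynomial.eq_of_eval_natCast_eq fun n => key n a

end Morphism

end
/-- There is exactly one morphism of double bialgebras `φ : 𝕂[NCP] → 𝕂[X]`; there are polynomials
`P n` with `P 0 = 1` such that `φ π = P |π|` for every nesting-free noncrossing partition `π`, and
the vector `(P 0, P 1, …)` is `e^{X ln M}` applied to `(1, 0, 0, …)`. Moreover `M` is the Riordan
array of `(1 + X, X (1 + X))`: its column `l` (numbered from `0`) has the generating series
`(1 + X) (X (1 + X))^l`. -/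
theorem proposition3p11 (K : Type*) [Field K] [CharZero K] :
    (∃! φ : NCAlg K →ₐ[K] Polynomial K, IsDoubleBialgebraHom φ) ∧
    (∀ φ : NCAlg K →ₐ[K] Polynomial K, IsDoubleBialgebraHom φ →
      ∃ P : ℕ → Polynomial K,
        P 0 = 1 ∧
        (∀ π : NCPartition, π.NestingFree → φ (MvPolynomial.X π) = P π.numBlocks) ∧
        P = (LowerTri.exp ((Polynomial.X : Polynomial K) •
          LowerTri.log (riordanM (Polynomial K)))).mulVec (Pi.single 0 1)) ∧
    (∀ l : ℕ, PowerSeries.mk (fun k => (riordanM K).entry k l) =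
      (1 + PowerSeries.X) * (PowerSeries.X * (1 + PowerSeries.X)) ^ l) := by
  have hM : ∀ k, (riordanM K - 1).entry k k = 0 := fun k => by
    rw [LowerTri.entry_sub, entry_riordanM, LowerTri.entry_one]
    simp
  have hmap : ∀ k l, (riordanM (Polynomial K)).entry k l =
      Polynomial.C ((riordanM K).entry k l) := fun k l => by
    rw [entry_riordanM, entry_riordanM]
    split_ifs <;> simp
  -- The polynomials `P n` are the interpolations of the first column of `M ^ N`, computed over `K`;
  -- `hmap` carries the result to the matrix over `K[X]`.
  refine ⟨⟨levelHom K, isDoubleBialgebraHom_levelHom K, fun ψ hψ =>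
    hψ.unique (isDoubleBialgebraHom_levelHom K)⟩, fun φ hφ => ⟨powEntry (riordanM K), ?_, ?_, ?_⟩,
    mk_entry_riordanM K⟩
  · simp [powEntry, LowerTri.entry_one]
  · intro π hπ
    rw [hφ.unique (isDoubleBialgebraHom_levelHom K), levelHom, MvPolynomial.aeval_X]
    refine Polynomial.eq_of_eval_natCast_eq fun n => ?_
    rw [eval_levelPolynomial, hπ.numLevel_eq, eval_powEntry hM, entry_riordanM_pow]
  · funext k
    rw [LowerTri.mulVec_single_zero, powEntry_eq_entry_exp hmap hM]
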